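/- **Lemma 3.1.** For $m\in\mathbb Z$ let $N_m=\{|m|,|m|+2,|m|+4,\dots\}$, and for $n\in N_m$ let $$V^m_n(re^{i\vartheta})=R^m_n(r)\,e^{im\vartheta},\qquad R^m_n(r)=\sum_{k=0}^{(n-|m|)/2}\frac{(-1)^k\,(n-k)!}{k!\,\bigl(\frac{n+|m|}2-k\bigr)!\,\bigl(\frac{n-|m|}2-k\bigr)!}\,r^{n-2k},$$ be the Zernike functions on the closed unit disk $\overline{\mathbb D}=\{z\in\mathbb C:|z|\le1\}$. Write $|x+iy|_1=|x|+|y|$ for $x,y\in\mathbb R$. Given a real number $\rho\ge1$, let $\mathcal A_\rho$ be the real vector space of all functions $u:\overline{\mathbb D}\to\mathbb C$ of the form $$u=\sum_{m\in\mathbb Z}\sum_{n\in N_m}u_{m,n}V^m_n,\qquad u_{m,n}\in\mathbb C,\qquad \|u\|_\rho=\sum_{m\in\mathbb Z}\sum_{n\in N_m}|u_{m,n}|_1\,\rho^n<\infty .$$ Every family $(u_{m,n})$ with $\sum|u_{m,n}|_1\rho^n<\infty$ defines such a function (the series converges unconditionally at every point of $\overline{\mathbb D}$), and the coefficients $u_{m,n}$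 are determined by $u$, so that $\|\cdot\|_\rho$ is well defined. Moreover: (a) $\mathcal A_\rho$ contains the constants and is closed under pointwise multiplication, $\|\cdot\|_\rho$ is a norm on the real vector space $\mathcal A_\rho$ for which $\mathcal A_\rho$ is complete, and $\|uv\|_\rho\le\|u\|_\rho\|v\|_\rho$ for all $u,v\in\mathcal A_\rho$. That is, $\mathcal A_\rho$ is a real Banach algebra under pointwise multiplication. (b) If $\rho>1$, there is an open set $U\subset\mathbb C^2$ containing $\{(x,y)\in\mathbb R^2:x^2+y^2\le1\}$ such that for every $u\in\mathcal A_\rho$ there is an analytic function $F$ on $U$ with $F(x,y)=u(x+iy)$ for all real $x,y$ with $x^2+y^2\le1$. -/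

import Mathlib

/-- The closed unit disk in the complex plane (a point `r e^{iϑ}` is the complex number `z`). -/
abbrev ZDisk : Type := Metric.closedBall (0 : ℂ) 1

/-- The set `N_m = {|m|, |m| + 2, |m| + 4, …}` of admissible degrees for the angular index `m`. -/
def zernikeN (m : ℤ) : Set ℕ := {n | ∃ l : ℕ, n = m.natAbs + 2 * l}

/-- The index set of the Zernike functions: pairs `(m, n)` with `m ∈ ℤ` and `n ∈ N_m`. -/
abbrev ZIndex : Type := {p : ℤ × ℕ // p.2 ∈ zernikeN p.1}

/-- The radial Zernike polynomial `R^m_n` (used for `n ∈ N_m`, where no natural number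
subtraction or division below truncates), normalized so that `R^m_n(1) = 1`. -/
noncomputable def zernikeR (m : ℤ) (n : ℕ) (r : ℝ) : ℝ :=
  ∑ k ∈ Finset.range ((n - m.natAbs) / 2 + 1),
    ((-1 : ℝ) ^ k * ((n - k).factorial : ℝ) /
      ((k.factorial : ℝ) * (((n + m.natAbs) / 2 - k).factorial : ℝ) *
        (((n - m.natAbs) / 2 - k).factorial : ℝ))) * r ^ (n - 2 * k)

/-- The Zernike function `V^m_n(r, ϑ) = R^m_n(r) e^{imϑ}`, as a function of `z = r e^{iϑ}`.
(At `z = 0` the angle is irrelevant, since `R^m_n(0) = 0` for `m ≠ 0`.) -/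
noncomputable def zernikeV (m : ℤ) (n : ℕ) (z : ℂ) : ℂ :=
  (zernikeR m n ‖z‖ : ℂ) * Complex.exp (Complex.I * (m : ℂ) * (Complex.arg z : ℂ))

/-- The norm `|x + iy|₁ = |x| + |y|` of a complex coefficient. -/
noncomputable def abs₁ (w : ℂ) : ℝ := |w.re| + |w.im|

/-- The coefficient family `c` has finite weighted `ℓ¹` norm. -/
def ZernikeSummable (ρ : ℝ) (c : ZIndex → ℂ) : Prop :=
  Summable fun p : ZIndex => abs₁ (c p) * ρ ^ p.1.2

/-- The weighted `ℓ¹` norm of a coefficient family. -/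
noncomputable def zernikeNorm (ρ : ℝ) (c : ZIndex → ℂ) : ℝ :=
  ∑' p : ZIndex, abs₁ (c p) * ρ ^ p.1.2

/-- `u` is the sum of the Zernike series with coefficients `c`, and these coefficients have
finite weighted `ℓ¹` norm. -/
def IsZernikeExpansion (ρ : ℝ) (c : ZIndex → ℂ) (u : ZDisk → ℂ) : Prop :=
  ZernikeSummable ρ c ∧
    ∀ z : ZDisk, HasSum (fun p : ZIndex => c p * zernikeV p.1.1 p.1.2 (z : ℂ)) (u z)

theorem abs₁_nonneg (w : ℂ) : 0 ≤ abs₁ w := by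
  unfold abs₁; positivity

theorem abs₁_add_le (v w : ℂ) : abs₁ (v + w) ≤ abs₁ v + abs₁ w := by
  have h1 := abs_add_le v.re w.re
  have h2 := abs_add_le v.im w.im
  simp only [abs₁, Complex.add_re, Complex.add_im]
  linarith

theorem abs₁_smul (a : ℝ) (w : ℂ) : abs₁ (a • w) = |a| * abs₁ w := by
  simp only [abs₁, Complex.real_smul, Complex.re_ofReal_mul, Complex.im_ofReal_mul, abs_mul]
  ring

/-- The real vector space `A_ρ` of all functions on the closed unit disk that have a Zernike
series with finite weighted `ℓ¹` norm (for weights `ρ ≥ 0`). -/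
noncomputable def zernikeSpace (ρ : NNReal) : Submodule ℝ (ZDisk → ℂ) where
  carrier := {u | ∃ c : ZIndex → ℂ, IsZernikeExpansion ρ c u}
  zero_mem' := by
    refine ⟨0, ?_, fun z => ?_⟩
    · simp [ZernikeSummable, abs₁]
    · simp
  add_mem' := by
    rintro u v ⟨c, hc, hu⟩ ⟨d, hd, hv⟩
    refine ⟨c + d, ?_, fun z => ?_⟩
    · refine Summable.of_nonneg_of_le (fun p => mul_nonneg (abs₁_nonneg _) (by positivity))
        (fun p => ?_) (hc.add hd)
      rw [← add_mul]
      exact mul_le_mul_of_nonneg_right (abs₁_add_le _ _) (by positivity)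
    · simpa [add_mul] using (hu z).add (hv z)
  smul_mem' := by
    rintro a u ⟨c, hc, hu⟩
    refine ⟨a • c, ?_, fun z => ?_⟩
    · have h := hc.mul_left |a|
      refine h.congr fun p => ?_
      rw [Pi.smul_apply, abs₁_smul, mul_assoc]
    · simpa [mul_assoc] using (hu z).mul_left (a : ℂ)

/-!
Put `a - b = m` and `a + b = n`. Then `V^m_n` is, up to normalization, the diagonal matrix
coefficient at the weight vector `x ^ a * y ^ b` of the `n`-th symmetric power of the standard
representation of `SU(2)`, as a function of the first entry `z` of the matrix
`!![z, w; -w, conj z]`, where `w = √(1 - |z|²)` may be taken real (`wignerCoeff_diag`,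
`zernikeV_zernikeIndex`). Everything follows from this, in an elementary form that uses only the
coefficients of powers of a bilinear form.

* Matrix coefficients of unitary representations are bounded, so `|V^m_n| ≤ 1` on the disk
  (`norm_diskPoly_le_one`), and series of finite norm converge uniformly.
* A product of two such coefficients is a diagonal coefficient of a tensor product. Decomposing it
  into irreducibles, where all weight spaces have dimension at most one, shows that it is a
  combination of Zernike functions with nonnegative coefficients (squares of Clebsch–Gordan
  coefficients) and degrees at most the sum of the degrees (`diskPoly_mul_mem_diskCone`). The
  coefficients sum to `1`, as `V^m_n(1) = 1`. This makes the norm submultiplicative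
  (`DiskSummable.exists_mul`). The decomposition is done one tensor factor at a time
  (`wignerForm_succ`).
* The special cases of multiplication by `z` and `conj z` are three-term recurrences. They reduce
  orthogonality on the disk to the fact that nonconstant Zernike functions have mean zero
  (`diskMean_diskFun`, `diskFun_orthogonal`), whence the coefficients are determined by the
  function. The space is therefore isometric to an `ℓ¹` space, and complete.
* The recurrences also give the generating function
  `∑ V s ^ a t ^ b = 1 / (1 - s z - t conj z + s t)`. With `s` and `t` the coordinates of modulus
  `1 / ρ` on a torus, it is an inverse in the Banach algebra of continuous functions on the torus,
  hence analytic in the complexified coordinates of the disk as long as the denominator is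
  invertible. A function in the space is the image of this inverse under a continuous functional,
  a sum of Fourier coefficients (`exists_analytic_extension`).
-/

open scoped NNReal

/-! ### Symmetric powers of a two-by-two matrix -/

section WignerMatrix

variable {R : Type*} [CommRing R]

/-- The coefficient of `σ₁ ^ i * σ₂ ^ (n - i) * ξ₁ ^ j * ξ₂ ^ (n - j)` in the `n`-th power of the
bilinear form `σ₁ (z ξ₁ + w ξ₂) + σ₂ (-w ξ₁ + zb ξ₂)`. Up to normalization, these are the matrix
coefficients of the `n`-th symmetric power of the matrix `!![z, w; -w, zb]`. The indices are
integers, and coefficients outside `0 ≤ i, j ≤ n` vanish, so that no boundary cases arise in the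
recurrences. -/
def wignerCoeff (z zb w : R) : ℕ → ℤ → ℤ → R
  | 0, i, j => if i = 0 ∧ j = 0 then 1 else 0
  | n + 1, i, j =>
      z * wignerCoeff z zb w n (i - 1) (j - 1) + w * wignerCoeff z zb w n (i - 1) j
        - w * wignerCoeff z zb w n i (j - 1) + zb * wignerCoeff z zb w n i j

variable (z zb w : R)

theorem wignerCoeff_succ (n : ℕ) (i j : ℤ) :
    wignerCoeff z zb w (n + 1) i j =
      z * wignerCoeff z zb w n (i - 1) (j - 1) + w * wignerCoeff z zb w n (i - 1) j
        - w * wignerCoeff z zb w n i (j - 1) + zb * wignerCoeff z zb w n i j := rfl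

theorem wignerCoeff_zero (i j : ℤ) :
    wignerCoeff z zb w 0 i j = if i = 0 ∧ j = 0 then 1 else 0 := rfl

theorem wignerCoeff_eq_zero {n : ℕ} {i j : ℤ} (h : i < 0 ∨ (n : ℤ) < i ∨ j < 0 ∨ (n : ℤ) < j) :
    wignerCoeff z zb w n i j = 0 := by
  induction n generalizing i j with
  | zero =>
    rw [wignerCoeff_zero, if_neg]
    push_cast at h
    omega
  | succ n ih =>
    push_cast at h
    have h1 : wignerCoeff z zb w n (i - 1) (j - 1) = 0 := ih (by omega)
    have h4 : wignerCoeff z zb w n i j = 0 := ih (by omega)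
    have h2 : wignerCoeff z zb w n (i - 1) j = 0 := ih (by omega)
    have h3 : wignerCoeff z zb w n i (j - 1) = 0 := ih (by omega)
    rw [wignerCoeff_succ, h1, h2, h3, h4]
    ring

/-- Comparison of coefficients in the derivative with respect to `σ₁` of the power of the bilinear
form. -/
theorem row_mul_wignerCoeff_succ (n : ℕ) (i j : ℤ) :
    (i : R) * wignerCoeff z zb w (n + 1) i j =
      (n + 1) * (z * wignerCoeff z zb w n (i - 1) (j - 1) + w * wignerCoeff z zb w n (i - 1) j) := by
  induction n generalizing i j with
  | zero =>
    simp only [wignerCoeff_succ, wignerCoeff_zero]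
    by_cases h0 : i = 0
    · subst h0; simp
    · by_cases h1 : i = 1
      · subst h1; simp
      · have h2 : i - 1 ≠ 0 := by omega
        simp [h0, h2]
  | succ n ih =>
    have a1 := ih (i - 1) (j - 1)
    have a2 := ih (i - 1) j
    have a3 := ih i (j - 1)
    have a4 := ih i j
    have b1 := wignerCoeff_succ z zb w n (i - 1) (j - 1)
    have b2 := wignerCoeff_succ z zb w n (i - 1) j
    rw [wignerCoeff_succ z zb w (n + 1) i j]
    push_cast at a1 a2 a3 a4 ⊢
    linear_combination z * a1 + w * a2 - w * a3 + zb * a4 - (n + 1) * z * b1 - (n + 1) * w * b2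

/-- Comparison of coefficients in the derivative with respect to `ξ₁` of the power of the bilinear
form. -/
theorem col_mul_wignerCoeff_succ (n : ℕ) (i j : ℤ) :
    (j : R) * wignerCoeff z zb w (n + 1) i j =
      (n + 1) * (z * wignerCoeff z zb w n (i - 1) (j - 1) - w * wignerCoeff z zb w n i (j - 1)) := by
  induction n generalizing i j with
  | zero =>
    simp only [wignerCoeff_succ, wignerCoeff_zero]
    by_cases h0 : j = 0
    · subst h0; simp
    · by_cases h1 : j = 1
      · subst h1; simp
      · have h2 : j - 1 ≠ 0 := by omega
        simp [h0, h2]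
  | succ n ih =>
    have a1 := ih (i - 1) (j - 1)
    have a2 := ih (i - 1) j
    have a3 := ih i (j - 1)
    have a4 := ih i j
    have b1 := wignerCoeff_succ z zb w n (i - 1) (j - 1)
    have b2 := wignerCoeff_succ z zb w n i (j - 1)
    rw [wignerCoeff_succ z zb w (n + 1) i j]
    push_cast at a1 a2 a3 a4 ⊢
    linear_combination z * a1 + w * a2 - w * a3 + zb * a4 - (n + 1) * z * b1 + (n + 1) * w * b2

/-- Comparison of coefficients in the derivative with respect to `σ₂` of the power of the bilinear
form. -/
theorem corow_mul_wignerCoeff_succ (n : ℕ) (i j : ℤ) :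
    ((n : R) + 1 - i) * wignerCoeff z zb w (n + 1) i j =
      (n + 1) * (zb * wignerCoeff z zb w n i j - w * wignerCoeff z zb w n i (j - 1)) := by
  linear_combination (n + 1 : R) * wignerCoeff_succ z zb w n i j
    - row_mul_wignerCoeff_succ z zb w n i j

/-- Comparison of coefficients in the derivative with respect to `ξ₂` of the power of the bilinear
form. -/
theorem cocol_mul_wignerCoeff_succ (n : ℕ) (i j : ℤ) :
    ((n : R) + 1 - j) * wignerCoeff z zb w (n + 1) i j =
      (n + 1) * (zb * wignerCoeff z zb w n i j + w * wignerCoeff z zb w n (i - 1) j) := by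
  linear_combination (n + 1 : R) * wignerCoeff_succ z zb w n i j
    - col_mul_wignerCoeff_succ z zb w n i j

variable {z zb w}

theorem row_mul_wignerCoeff_zero (i j : ℤ) : (i : R) * wignerCoeff z zb w 0 i j = 0 := by
  rw [wignerCoeff_zero]
  split_ifs with h
  · simp [h.1]
  · simp

theorem col_mul_wignerCoeff_zero (i j : ℤ) : (j : R) * wignerCoeff z zb w 0 i j = 0 := by
  rw [wignerCoeff_zero]
  split_ifs with h
  · simp [h.2]
  · simp

/-- The Clebsch–Gordan decomposition of the tensor product of the `n`-th symmetric power with the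
standard representation, at the entry `z` of the matrix of determinant one `!![z, w; -w, zb]`. The
next three lemmas treat the other entries. In all four, the coefficient of
`wignerCoeff z zb w (n + 1)` is a product `p i * p j` and that of `wignerCoeff z zb w (n - 1)` is
`(n + 1) * n * (ε * ε')` with signs `ε` (of the row) and `ε'` (of the column); this product form
is what makes `wignerForm_succ` a sum of two forms of the same kind. -/
theorem mul_wignerCoeff_one_one (h : z * zb + w ^ 2 = 1) (n : ℕ) (i j : ℤ) :
    (n + 1 : R) ^ 2 * (z * wignerCoeff z zb w n i j) =
      (i + 1) * (j + 1) * wignerCoeff z zb w (n + 1) (i + 1) (j + 1)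
        + (n + 1) * n * wignerCoeff z zb w (n - 1) i j := by
  have a := row_mul_wignerCoeff_succ z zb w n (i + 1) (j + 1)
  cases n with
  | zero =>
    have b := col_mul_wignerCoeff_zero (z := z) (zb := zb) (w := w) i j
    have b' := col_mul_wignerCoeff_zero (z := z) (zb := zb) (w := w) i (j + 1)
    simp only [add_sub_cancel_right] at a
    push_cast at a b b' ⊢
    linear_combination -(j + 1 : R) * a - z * b - w * b'
  | succ m =>
    have b := col_mul_wignerCoeff_succ z zb w m i j
    have b' := col_mul_wignerCoeff_succ z zb w m i (j + 1)
    have c := wignerCoeff_succ z zb w m i j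
    simp only [add_sub_cancel_right, Nat.add_sub_cancel] at a b b' c ⊢
    push_cast at a b b' c ⊢
    linear_combination -(j + 1 : R) * a - (m + 2 : R) * (z * b + w * b')
      + (m + 2 : R) * (m + 1) * z * c + (m + 2 : R) * (m + 1) * wignerCoeff z zb w m i j * h

theorem mul_wignerCoeff_one_zero (h : z * zb + w ^ 2 = 1) (n : ℕ) (i j : ℤ) :
    (n + 1 : R) ^ 2 * (w * wignerCoeff z zb w n i j) =
      (i + 1) * (n + 1 - j) * wignerCoeff z zb w (n + 1) (i + 1) j
        - (n + 1) * n * wignerCoeff z zb w (n - 1) i (j - 1) := by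
  have a := row_mul_wignerCoeff_succ z zb w n (i + 1) j
  cases n with
  | zero =>
    have b := col_mul_wignerCoeff_zero (z := z) (zb := zb) (w := w) i j
    have b' := col_mul_wignerCoeff_zero (z := z) (zb := zb) (w := w) i (j - 1)
    simp only [add_sub_cancel_right] at a
    push_cast at a b b' ⊢
    linear_combination -(1 - j : R) * a + z * b' + w * b
  | succ m =>
    have b := cocol_mul_wignerCoeff_succ z zb w m i j
    have b' := cocol_mul_wignerCoeff_succ z zb w m i (j - 1)
    have c := wignerCoeff_succ z zb w m i j
    simp only [add_sub_cancel_right, Nat.add_sub_cancel] at a b b' c ⊢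
    push_cast at a b b' c ⊢
    linear_combination -(m + 2 - j : R) * a - (m + 2 : R) * (z * b' + w * b)
      + (m + 2 : R) * (m + 1) * w * c - (m + 2 : R) * (m + 1) * wignerCoeff z zb w m i (j - 1) * h

theorem mul_wignerCoeff_zero_one (h : z * zb + w ^ 2 = 1) (n : ℕ) (i j : ℤ) :
    (n + 1 : R) ^ 2 * (-w * wignerCoeff z zb w n i j) =
      (n + 1 - i) * (j + 1) * wignerCoeff z zb w (n + 1) i (j + 1)
        - (n + 1) * n * wignerCoeff z zb w (n - 1) (i - 1) j := by
  have a := col_mul_wignerCoeff_succ z zb w n i (j + 1)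
  cases n with
  | zero =>
    have b := row_mul_wignerCoeff_zero (z := z) (zb := zb) (w := w) i j
    have b' := row_mul_wignerCoeff_zero (z := z) (zb := zb) (w := w) (i - 1) j
    simp only [add_sub_cancel_right] at a
    push_cast at a b b' ⊢
    linear_combination -(1 - i : R) * a + z * b' - w * b
  | succ m =>
    have b := corow_mul_wignerCoeff_succ z zb w m i j
    have b' := corow_mul_wignerCoeff_succ z zb w m (i - 1) j
    have c := wignerCoeff_succ z zb w m i j
    simp only [add_sub_cancel_right, Nat.add_sub_cancel] at a b b' c ⊢
    push_cast at a b b' c ⊢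
    linear_combination -(m + 2 - i : R) * a - (m + 2 : R) * (z * b' - w * b)
      - (m + 2 : R) * (m + 1) * w * c - (m + 2 : R) * (m + 1) * wignerCoeff z zb w m (i - 1) j * h

theorem mul_wignerCoeff_zero_zero (h : z * zb + w ^ 2 = 1) (n : ℕ) (i j : ℤ) :
    (n + 1 : R) ^ 2 * (zb * wignerCoeff z zb w n i j) =
      (n + 1 - i) * (n + 1 - j) * wignerCoeff z zb w (n + 1) i j
        + (n + 1) * n * wignerCoeff z zb w (n - 1) (i - 1) (j - 1) := by
  have a := corow_mul_wignerCoeff_succ z zb w n i j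
  cases n with
  | zero =>
    have b := col_mul_wignerCoeff_zero (z := z) (zb := zb) (w := w) i j
    have b' := col_mul_wignerCoeff_zero (z := z) (zb := zb) (w := w) i (j - 1)
    push_cast at a b b' ⊢
    linear_combination -(1 - j : R) * a + zb * b - w * b'
  | succ m =>
    have b := cocol_mul_wignerCoeff_succ z zb w m i j
    have b' := cocol_mul_wignerCoeff_succ z zb w m i (j - 1)
    have c := wignerCoeff_succ z zb w m i j
    simp only [Nat.add_sub_cancel] at a b b' c ⊢
    push_cast at a b b' c ⊢
    linear_combination -(m + 2 - j : R) * a - (m + 2 : R) * (zb * b - w * b')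
      + (m + 2 : R) * (m + 1) * zb * c
      + (m + 2 : R) * (m + 1) * wignerCoeff z zb w m (i - 1) (j - 1) * h

end WignerMatrix

/-! ### Disk polynomials and their recurrences -/

section DiskPolynomial

variable {R : Type*} [CommRing R]

/-- The polynomial in `z` and `zb` which at `zb = conj z` is the Zernike function of angular index
`a - b` and degree `a + b`, see `zernikeV_zernikeIndex`. The coefficient of
`z ^ (a - k) * zb ^ (b - k)` is up to sign the multinomial
`(a + b - k)! / (k! (a - k)! (b - k)!)`, written with binomials so that it vanishes where the
natural number subtractions in the exponents would truncate. -/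
def diskPoly (z zb : R) (a b : ℕ) : R :=
  ∑ k ∈ Finset.range (a + 1),
    (-1) ^ k * ((a + b - k).choose a * a.choose k : ℕ) * (z ^ (a - k) * zb ^ (b - k))

variable (z zb : R)

theorem diskPoly_zero_left (b : ℕ) : diskPoly z zb 0 b = zb ^ b := by
  simp [diskPoly]

theorem diskPoly_zero_right (a : ℕ) : diskPoly z zb a 0 = z ^ a := by
  unfold diskPoly
  rw [Finset.sum_range_succ', Finset.sum_eq_zero]
  · simp
  · intro k hk
    rw [Nat.choose_eq_zero_of_lt (by simp at hk; omega)]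
    simp

/-- The recurrence expressing that `∑ diskPoly z zb a b * s ^ a * t ^ b` is the expansion of
`1 / (1 - s z - t zb + s t)`. -/
theorem diskPoly_succ_succ (a b : ℕ) :
    diskPoly z zb (a + 1) (b + 1) =
      z * diskPoly z zb a (b + 1) + zb * diskPoly z zb (a + 1) b - diskPoly z zb a b := by
  -- the first sum gets a vanishing term at `k = a + 1`, and the last one is shifted by one
  have e1 : z * diskPoly z zb a (b + 1) = ∑ k ∈ Finset.range (a + 1 + 1),
      (-1) ^ k * ((a + b + 1 - k).choose a * a.choose k : ℕ)
        * (z ^ (a + 1 - k) * zb ^ (b + 1 - k)) := by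
    rw [Finset.sum_range_succ, Nat.choose_succ_self, diskPoly, Finset.mul_sum]
    simp only [mul_zero, Nat.cast_zero, zero_mul, add_zero]
    refine Finset.sum_congr rfl fun k hk => ?_
    have hk' : k ≤ a := by simpa [Nat.lt_succ_iff] using hk
    rw [show a + 1 - k = a - k + 1 by omega, ← add_assoc]
    ring
  have e2 : zb * diskPoly z zb (a + 1) b = ∑ k ∈ Finset.range (a + 1 + 1),
      (-1) ^ k * ((a + b + 1 - k).choose (a + 1) * (a + 1).choose k : ℕ)
        * (z ^ (a + 1 - k) * zb ^ (b + 1 - k)) := by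
    rw [diskPoly, Finset.mul_sum]
    refine Finset.sum_congr rfl fun k hk => ?_
    rw [show a + 1 + b = a + b + 1 by ring]
    by_cases hkb : k ≤ b
    · rw [show b + 1 - k = b - k + 1 by omega]
      ring
    · rw [Nat.choose_eq_zero_of_lt (by omega)]
      simp
  have e3 : diskPoly z zb a b = ∑ k ∈ Finset.range (a + 1),
      (-1) ^ k * ((a + b - k).choose a * a.choose k : ℕ)
        * (z ^ (a + 1 - (k + 1)) * zb ^ (b + 1 - (k + 1))) := by
    simp [diskPoly]
  rw [e1, e2, ← Finset.sum_add_distrib, Finset.sum_range_succ', e3, add_sub_right_comm,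
    ← Finset.sum_sub_distrib, diskPoly, Finset.sum_range_succ']
  congr 1
  · refine Finset.sum_congr rfl fun k hk => ?_
    have hk' : k ≤ a := by simpa [Nat.lt_succ_iff] using hk
    rw [show a + 1 + (b + 1) - (k + 1) = (a + b - k) + 1 by omega,
      show a + b + 1 - (k + 1) = a + b - k by omega, Nat.choose_succ_succ (a + b - k) a,
      Nat.choose_succ_succ a k]
    push_cast
    ring
  · rw [show a + 1 + (b + 1) - 0 = (a + b + 1) + 1 by omega, Nat.choose_succ_succ (a + b + 1) a]
    simp
    ring

variable {z zb} {w : R}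

theorem wignerCoeff_self (n : ℕ) : wignerCoeff z zb w n n n = z ^ n := by
  induction n with
  | zero => simp [wignerCoeff_zero]
  | succ n ih =>
    rw [wignerCoeff_succ, wignerCoeff_eq_zero (i := ((n + 1 : ℕ) : ℤ) - 1) (j := ((n + 1 : ℕ) : ℤ)),
      wignerCoeff_eq_zero (i := ((n + 1 : ℕ) : ℤ)), wignerCoeff_eq_zero (i := ((n + 1 : ℕ) : ℤ))]
    · push_cast
      simp only [add_sub_cancel_right, ih]
      ring
    all_goals push_cast; omega

theorem wignerCoeff_zero_zero (n : ℕ) : wignerCoeff z zb w n 0 0 = zb ^ n := by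
  induction n with
  | zero => simp [wignerCoeff_zero]
  | succ n ih =>
    rw [wignerCoeff_succ, wignerCoeff_eq_zero (i := 0 - 1), wignerCoeff_eq_zero (i := 0 - 1),
      wignerCoeff_eq_zero (j := 0 - 1), ih]
    · ring
    all_goals omega

/-- Positive integers are cancellable in a real algebra, even if it has zero divisors. -/
theorem eq_of_natCast_succ_mul_eq [Algebra ℝ R] (n : ℕ) {x y : R}
    (h : (n + 1 : R) * x = (n + 1) * y) : x = y := by
  have hn : (n + 1 : ℝ) ≠ 0 := by positivity
  have e : (n + 1 : R) = algebraMap ℝ R (n + 1) := by simp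
  rw [e, ← Algebra.smul_def, ← Algebra.smul_def] at h
  exact smul_right_injective R hn h

/-- The disk polynomials are the diagonal matrix coefficients of the symmetric powers: both sides
satisfy the recurrence `diskPoly_succ_succ`. -/
theorem wignerCoeff_diag [Algebra ℝ R] (h : z * zb + w ^ 2 = 1) (a b : ℕ) :
    wignerCoeff z zb w (a + b) a a = (a + b).choose a * diskPoly z zb a b := by
  induction hn : a + b using Nat.strong_induction_on generalizing a b with
  | _ n ih =>
  subst hn
  rcases a with _ | a
  · simp [wignerCoeff_zero_zero, diskPoly_zero_left]
  rcases b with _ | b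
  · simp only [add_zero]
    rw [wignerCoeff_self, diskPoly_zero_right, Nat.choose_self, Nat.cast_one, one_mul]
  have i1 := ih _ (by omega) a (b + 1) rfl
  have i2 := ih _ (by omega) (a + 1) b rfl
  have i3 := ih _ (by omega) a b rfl
  have E1 := mul_wignerCoeff_one_one h (a + (b + 1)) a a
  have E2 := mul_wignerCoeff_zero_zero h (a + (b + 1)) (a + 1 : ℕ) (a + 1 : ℕ)
  rw [show a + (b + 1) - 1 = a + b by omega] at E1 E2
  rw [show a + 1 + (b + 1) = a + (b + 1) + 1 by ring]
  rw [show a + 1 + b = a + (b + 1) by ring] at i2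
  rw [i1, i3] at E1
  rw [i2, show ((a + 1 : ℕ) : ℤ) - 1 = (a : ℤ) by push_cast; ring, i3] at E2
  have c1 : ((a + (b + 1)).choose a : R) * (a + b + 2) =
      (a + 1) * ((a + (b + 1) + 1).choose (a + 1) : R) := by
    have := Nat.add_one_mul_choose_eq (a + (b + 1)) a
    have := congrArg (Nat.cast : ℕ → R) this
    push_cast at this
    linear_combination this
  have c2 : ((a + (b + 1)).choose (a + 1) : R) * (a + b + 2) =
      (b + 1) * ((a + (b + 1) + 1).choose (a + 1) : R) := by
    have := Nat.choose_mul_succ_eq (a + (b + 1)) (a + 1)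
    rw [show a + (b + 1) + 1 - (a + 1) = b + 1 by omega] at this
    have := congrArg (Nat.cast : ℕ → R) this
    push_cast at this
    linear_combination this
  have c3 : ((a + b).choose a : R) * (a + b + 1) = (b + 1) * ((a + (b + 1)).choose a : R) := by
    have := Nat.choose_mul_succ_eq (a + b) a
    rw [show a + b + 1 - a = b + 1 by omega, add_assoc] at this
    have := congrArg (Nat.cast : ℕ → R) this
    push_cast at this
    linear_combination this
  apply eq_of_natCast_succ_mul_eq a
  apply eq_of_natCast_succ_mul_eq b
  apply eq_of_natCast_succ_mul_eq (a + b + 1)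
  rw [diskPoly_succ_succ]
  push_cast at E1 E2 c1 c2 c3 ⊢
  linear_combination -(b + 1 : R) * E1 - (a + 1 : R) * E2
    + (b + 1 : R) * (a + b + 2) * z * diskPoly z zb a (b + 1) * c1
    + (a + 1 : R) * (a + b + 2) * zb * diskPoly z zb (a + 1) b * c2
    - diskPoly z zb a b * ((a + b + 2) ^ 2 * c3 + (a + b + 2) * (b + 1) * c1)

theorem eq_of_natCast_choose_mul_eq [Algebra ℝ R] (a b : ℕ) {x y : R}
    (h : ((a + b).choose a : R) * x = ((a + b).choose a : R) * y) : x = y := by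
  have : (a + b).choose a ≠ 0 := (Nat.choose_pos (by omega)).ne'
  obtain ⟨m, hm⟩ := Nat.exists_eq_succ_of_ne_zero this
  rw [hm] at h
  push_cast at h
  exact eq_of_natCast_succ_mul_eq m h

/-- Three-term recurrence for multiplication by `z`. -/
theorem mul_diskPoly [Algebra ℝ R] (h : z * zb + w ^ 2 = 1) (a b : ℕ) :
    (a + b + 2) * (z * diskPoly z zb a (b + 1)) =
      (a + 1) * diskPoly z zb (a + 1) (b + 1) + (b + 1) * diskPoly z zb a b := by
  have E1 := mul_wignerCoeff_one_one h (a + (b + 1)) a a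
  have d := wignerCoeff_diag h (a + 1) (b + 1)
  rw [show a + (b + 1) - 1 = a + b by omega, wignerCoeff_diag h, wignerCoeff_diag h] at E1
  rw [show a + 1 + (b + 1) = a + (b + 1) + 1 by ring] at d
  push_cast at E1 d
  rw [d] at E1
  have c1 : ((a + (b + 1)).choose a : R) * (a + b + 2) =
      (a + 1) * ((a + (b + 1) + 1).choose (a + 1) : R) := by
    have := Nat.add_one_mul_choose_eq (a + (b + 1)) a
    have := congrArg (Nat.cast : ℕ → R) this
    push_cast at this
    linear_combination this
  have c3 : ((a + b).choose a : R) * (a + b + 1) = (b + 1) * ((a + (b + 1)).choose a : R) := by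
    have := Nat.choose_mul_succ_eq (a + b) a
    rw [show a + b + 1 - a = b + 1 by omega, add_assoc] at this
    have := congrArg (Nat.cast : ℕ → R) this
    push_cast at this
    linear_combination this
  apply eq_of_natCast_choose_mul_eq a (b + 1)
  apply eq_of_natCast_succ_mul_eq (a + b + 1)
  push_cast
  linear_combination E1 - (a + 1 : R) * diskPoly z zb (a + 1) (b + 1) * c1
    + (a + b + 2) * diskPoly z zb a b * c3

/-- Three-term recurrence for multiplication by `zb`. -/
theorem conj_mul_diskPoly [Algebra ℝ R] (h : z * zb + w ^ 2 = 1) (a b : ℕ) :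
    (a + b + 2) * (zb * diskPoly z zb (a + 1) b) =
      (b + 1) * diskPoly z zb (a + 1) (b + 1) + (a + 1) * diskPoly z zb a b := by
  linear_combination (a + b + 2 : R) * -diskPoly_succ_succ z zb a b - mul_diskPoly h a b

end DiskPolynomial

/-! ### Nonnegativity of the linearization coefficients -/

section Linearization

variable {R : Type*} [CommRing R]

/-- Summation by parts along a Pascal-type recurrence with vanishing boundary values. -/
theorem sum_mul_shift_add (m : ℕ) (f A B : ℤ → R) (hA : A (-1) = 0) (hB : B (m + 1) = 0) :
    ∑ c ∈ Finset.range (m + 2), f c * (A (c - 1) + B c) =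
      ∑ c ∈ Finset.range (m + 1), (f (c + 1) * A c + f c * B c) := by
  simp only [mul_add, Finset.sum_add_distrib]
  congr 1
  · rw [Finset.sum_range_succ']
    simp [hA]
  · rw [Finset.sum_range_succ]
    simp [hB]

variable (z zb w : R)

theorem sum_mul_wignerCoeff_succ (m : ℕ) (f : ℤ → ℤ → R) :
    ∑ c ∈ Finset.range (m + 2), ∑ d ∈ Finset.range (m + 2),
        f c d * wignerCoeff z zb w (m + 1) c d =
      ∑ c ∈ Finset.range (m + 1), ∑ d ∈ Finset.range (m + 1),
        wignerCoeff z zb w m c d *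
          (f (c + 1) (d + 1) * z + f (c + 1) d * w - f c (d + 1) * w + f c d * zb) := by
  have inner : ∀ c : ℤ, ∑ d ∈ Finset.range (m + 2), f c d * wignerCoeff z zb w (m + 1) c d =
      ∑ d ∈ Finset.range (m + 1),
        (f c (d + 1) * (z * wignerCoeff z zb w m (c - 1) d - w * wignerCoeff z zb w m c d) +
          f c d * (w * wignerCoeff z zb w m (c - 1) d + zb * wignerCoeff z zb w m c d)) := by
    intro c
    rw [← sum_mul_shift_add m (f c)
      (fun d => z * wignerCoeff z zb w m (c - 1) d - w * wignerCoeff z zb w m c d)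
      (fun d => w * wignerCoeff z zb w m (c - 1) d + zb * wignerCoeff z zb w m c d)]
    · refine Finset.sum_congr rfl fun d _ => ?_
      rw [wignerCoeff_succ]
      ring
    · have v : ∀ c, wignerCoeff z zb w m c (-1) = 0 :=
        fun c => wignerCoeff_eq_zero z zb w (by omega)
      simp [v]
    · have v : ∀ c, wignerCoeff z zb w m c (m + 1) = 0 :=
        fun c => wignerCoeff_eq_zero z zb w (by omega)
      simp [v]
  simp only [inner]
  rw [Finset.sum_comm]
  conv_rhs => rw [Finset.sum_comm]
  refine Finset.sum_congr rfl fun d hd => ?_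
  have outer := fun g : ℤ → R => sum_mul_shift_add m g (fun c => wignerCoeff z zb w m c d) 0
    (wignerCoeff_eq_zero z zb w (by omega)) rfl
  have outer' := fun g : ℤ → R => sum_mul_shift_add m g 0 (fun c => wignerCoeff z zb w m c d)
    rfl (wignerCoeff_eq_zero z zb w (by omega))
  simp only [Pi.zero_apply, add_zero, zero_add, mul_zero] at outer outer'
  calc _ = ∑ c ∈ Finset.range (m + 2), (f c (d + 1) * z + f c d * w)
            * wignerCoeff z zb w m (c - 1) d
          + ∑ c ∈ Finset.range (m + 2), (f c d * zb - f c (d + 1) * w)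
            * wignerCoeff z zb w m c d := by
        rw [← Finset.sum_add_distrib]
        exact Finset.sum_congr rfl fun c _ => by ring
    _ = _ := by
        rw [outer fun c => f c (d + 1) * z + f c d * w,
          outer' fun c => f c d * zb - f c (d + 1) * w, ← Finset.sum_add_distrib]
        exact Finset.sum_congr rfl fun c _ => by ring

theorem diskPoly_one_one (a b : ℕ) : diskPoly (1 : R) 1 a b = 1 := by
  induction hn : a + b using Nat.strong_induction_on generalizing a b with
  | _ n ih =>
  subst hn
  rcases a with _ | a
  · simp [diskPoly_zero_left]
  rcases b with _ | b
  · simp [diskPoly_zero_right]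
  rw [diskPoly_succ_succ, ih _ (by omega) a (b + 1) rfl, ih _ (by omega) (a + 1) b rfl,
    ih _ (by omega) a b rfl]
  ring

variable [Algebra ℝ R]

/-- The diagonal matrix coefficient, at the vector with coefficients `u` in the weight space of
weight `W`, of the tensor product of the `n`-th and the `m`-th symmetric power. -/
def wignerForm (n m : ℕ) (W : ℤ) (u : ℤ → ℝ) : R :=
  ∑ c ∈ Finset.range (m + 1), ∑ d ∈ Finset.range (m + 1),
    algebraMap ℝ R (u c * u d) *
      (wignerCoeff z zb w n (W - c) (W - d) * wignerCoeff z zb w m c d)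

variable {z zb w}

/-- Splitting one tensor factor off the `m + 1`-st symmetric power and absorbing it into the
`n`-th one by the Clebsch–Gordan rule turns a form into a nonnegative combination of two forms
with smaller `m`. -/
theorem wignerForm_succ (h : z * zb + w ^ 2 = 1) (n m : ℕ) (W : ℤ) (u : ℤ → ℝ) :
    algebraMap ℝ R ((n + 1) ^ 2) * wignerForm z zb w n (m + 1) W u =
      wignerForm z zb w (n + 1) m W (fun c => (W - c) * u (c + 1) + (n + 1 - W + c) * u c)
        + algebraMap ℝ R ((n + 1) * n) *
          wignerForm z zb w (n - 1) m (W - 1) (fun c => u (c + 1) - u c) := by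
  have key := sum_mul_wignerCoeff_succ z zb w m
    (fun c d => algebraMap ℝ R (u c * u d) * wignerCoeff z zb w n (W - c) (W - d))
  have e := show wignerForm z zb w n (m + 1) W u = _ from Eq.trans
    (by simp only [wignerForm, ← mul_assoc]) key
  rw [e, wignerForm, wignerForm]
  simp only [Finset.mul_sum, ← Finset.sum_add_distrib]
  refine Finset.sum_congr rfl fun c _ => Finset.sum_congr rfl fun d _ => ?_
  have E11 := mul_wignerCoeff_one_one h n (W - (c + 1)) (W - (d + 1))
  have E10 := mul_wignerCoeff_one_zero h n (W - (c + 1)) (W - d)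
  have E01 := mul_wignerCoeff_zero_one h n (W - c) (W - (d + 1))
  have E00 := mul_wignerCoeff_zero_zero h n (W - c) (W - d)
  have r1 : ∀ c : ℤ, W - (c + 1) + 1 = W - c := fun c => by ring
  have r2 : ∀ c : ℤ, W - (c + 1) = W - 1 - c := fun c => by ring
  have r3 : ∀ c : ℤ, W - c - 1 = W - 1 - c := fun c => by ring
  simp only [r1, r3] at E11 E10 E01 E00
  simp only [r2] at E11 E10 E01 E00 ⊢
  simp only [map_mul, map_add, map_sub, map_pow, map_one, map_natCast, map_intCast] at *
  push_cast at E11 E10 E01 E00 ⊢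
  set U := algebraMap ℝ R
  linear_combination wignerCoeff z zb w m c d * (U (u (c + 1)) * U (u (d + 1)) * E11
    + U (u (c + 1)) * U (u d) * E10 + U (u c) * U (u (d + 1)) * E01 + U (u c) * U (u d) * E00)

variable (z zb) in
/-- Nonnegative real combinations of the disk polynomials of degree at most `n`. -/
def diskCone (n : ℕ) : Submodule ℝ≥0 R :=
  Submodule.span ℝ≥0 ((fun p : ℕ × ℕ => diskPoly z zb p.1 p.2) '' {p | p.1 + p.2 ≤ n})

theorem algebraMap_mul_mem_diskCone {n : ℕ} {x : R} {r : ℝ} (hr : 0 ≤ r)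
    (hx : x ∈ diskCone z zb n) : algebraMap ℝ R r * x ∈ diskCone z zb n := by
  have := (diskCone z zb n).smul_mem ⟨r, hr⟩ hx
  rwa [← Algebra.smul_def]

theorem diskCone_mono {n m : ℕ} (h : n ≤ m) : (diskCone z zb n : Submodule ℝ≥0 R) ≤ diskCone z zb m :=
  Submodule.span_mono (Set.image_mono fun p (hp : p.1 + p.2 ≤ n) => hp.trans h)

theorem mem_of_algebraMap_mul_mem_diskCone {n : ℕ} {x : R} {r : ℝ} (hr : 0 < r)
    (hx : algebraMap ℝ R r * x ∈ diskCone z zb n) : x ∈ diskCone z zb n := by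
  have := algebraMap_mul_mem_diskCone (inv_pos.2 hr).le hx
  rwa [← mul_assoc, ← map_mul, inv_mul_cancel₀ hr.ne', map_one, one_mul] at this

theorem diskPoly_mem_diskCone (a b : ℕ) : diskPoly z zb a b ∈ diskCone z zb (a + b) :=
  Submodule.subset_span ⟨(a, b), le_refl (a + b), rfl⟩

theorem wignerForm_mem_diskCone (h : z * zb + w ^ 2 = 1) (n m : ℕ) (W : ℤ) (u : ℤ → ℝ) :
    wignerForm z zb w n m W u ∈ diskCone z zb (n + m) := by
  induction m generalizing n W u with
  | zero =>
    have e : wignerForm z zb w n 0 W u =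
        algebraMap ℝ R (u 0 * u 0) * wignerCoeff z zb w n W W := by
      simp [wignerForm, wignerCoeff_zero]
    rw [e]
    refine algebraMap_mul_mem_diskCone (mul_self_nonneg _) ?_
    by_cases hW : 0 ≤ W ∧ W ≤ n
    · obtain ⟨a, rfl⟩ := Int.eq_ofNat_of_zero_le hW.1
      obtain ⟨b, rfl⟩ := Nat.exists_eq_add_of_le (show a ≤ n by omega)
      rw [wignerCoeff_diag h, ← map_natCast (algebraMap ℝ R)]
      exact algebraMap_mul_mem_diskCone (Nat.cast_nonneg _) (diskPoly_mem_diskCone a b)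
    · rw [wignerCoeff_eq_zero]
      · exact Submodule.zero_mem _
      · omega
  | succ m ih =>
    refine mem_of_algebraMap_mul_mem_diskCone (r := ((n : ℝ) + 1) ^ 2) (by positivity) ?_
    rw [wignerForm_succ h]
    refine Submodule.add_mem _ ?_ (algebraMap_mul_mem_diskCone (by positivity) ?_)
    · exact diskCone_mono (by omega) (ih (n + 1) W _)
    · exact diskCone_mono (by omega) (ih (n - 1) (W - 1) _)

/-- The linearization coefficients of disk polynomials are nonnegative. This is the case of
`wignerForm_mem_diskCone` where the weight vector is a pure tensor of basis vectors. -/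
theorem diskPoly_mul_mem_diskCone (h : z * zb + w ^ 2 = 1) (a b c d : ℕ) :
    diskPoly z zb a b * diskPoly z zb c d ∈ diskCone z zb (a + b + (c + d)) := by
  have key := wignerForm_mem_diskCone h (a + b) (c + d) (a + c) (fun i => if i = c then 1 else 0)
  have e : wignerForm z zb w (a + b) (c + d) (a + c) (fun i => if i = c then 1 else 0) =
      wignerCoeff z zb w (a + b) a a * wignerCoeff z zb w (c + d) c c := by
    unfold wignerForm
    rw [Finset.sum_eq_single c, Finset.sum_eq_single c]
    · simp
    · intro x _ hx
      simp [hx]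
    · simp
    · intro x _ hx
      simp [hx]
    · simp
  rw [e, wignerCoeff_diag h, wignerCoeff_diag h] at key
  refine mem_of_algebraMap_mul_mem_diskCone
    (r := ((a + b).choose a * (c + d).choose c : ℕ)) ?_ ?_
  · exact_mod_cast Nat.mul_pos (Nat.choose_pos (by omega)) (Nat.choose_pos (by omega))
  · rw [map_natCast]
    push_cast
    convert key using 1
    ring

end Linearization

/-! ### The bound by one on the disk -/

section UnitaryBound

open ComplexConjugate

/-- Pascal recurrence for the weighted square sums of the rows, which holds because the matrix
`!![z, w; -w, conj z]` is unitary. -/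
theorem sum_norm_sq_wignerCoeff_succ {z : ℂ} {w : ℝ} (h : ‖z‖ ^ 2 + w ^ 2 = 1) (n : ℕ) (i : ℤ) :
    ∑ j ∈ Finset.range (n + 2),
        ‖wignerCoeff z (conj z) (w : ℂ) (n + 1) i j‖ ^ 2 / (n + 1).choose j =
      ∑ j ∈ Finset.range (n + 1), ‖wignerCoeff z (conj z) (w : ℂ) n (i - 1) j‖ ^ 2 / n.choose j
        + ∑ j ∈ Finset.range (n + 1), ‖wignerCoeff z (conj z) (w : ℂ) n i j‖ ^ 2 / n.choose j := by
  set S := wignerCoeff z (conj z) (w : ℂ) with hS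
  have hn : (n + 1 : ℝ) ≠ 0 := by positivity
  have hA : ∀ j : ℕ, ((j : ℝ) + 1) / (n + 1) * (‖S (n + 1) i (j + 1)‖ ^ 2 / (n + 1).choose (j + 1)) =
      ‖z * S n (i - 1) j - w * S n i j‖ ^ 2 / n.choose j := by
    intro j
    have e := col_mul_wignerCoeff_succ z (conj z) (w : ℂ) n i (j + 1)
    rw [add_sub_cancel_right] at e
    have e' := congrArg (fun x : ℂ => ‖x‖ ^ 2) e
    simp only [norm_mul, mul_pow, ← hS] at e'
    have n1 : ‖(((j : ℤ) + 1 : ℤ) : ℂ)‖ = j + 1 := by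
      rw [show (((j : ℤ) + 1 : ℤ) : ℂ) = ((j + 1 : ℕ) : ℂ) by push_cast; rfl, Complex.norm_natCast]
      push_cast; rfl
    have n2 : ‖(n + 1 : ℂ)‖ = n + 1 := by
      rw [show (n + 1 : ℂ) = ((n + 1 : ℕ) : ℂ) by push_cast; rfl, Complex.norm_natCast]
      push_cast; rfl
    rw [n1, n2] at e'
    have c : ((n : ℝ) + 1) * n.choose j = (n + 1).choose (j + 1) * (j + 1) := by
      exact_mod_cast Nat.add_one_mul_choose_eq n j
    by_cases hj : j ≤ n
    · have p1 : (0 : ℝ) < n.choose j := by exact_mod_cast Nat.choose_pos hj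
      have p2 : (0 : ℝ) < (n + 1).choose (j + 1) := by
        exact_mod_cast Nat.choose_pos (show j + 1 ≤ n + 1 by omega)
      have p3 : (j + 1 : ℝ) ≠ 0 := by positivity
      rw [div_mul_div_comm, div_eq_div_iff (by positivity) (by positivity)]
      apply mul_left_cancel₀ p3
      linear_combination (n.choose j : ℝ) * e' +
        (n + 1 : ℝ) * ‖z * S n (i - 1) j - w * S n i j‖ ^ 2 * c
    · rw [Nat.choose_eq_zero_of_lt (show n < j by omega),
        Nat.choose_eq_zero_of_lt (show n + 1 < j + 1 by omega)]
      simp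
  have hB : ∀ j ∈ Finset.range (n + 1),
      ((n : ℝ) + 1 - j) / (n + 1) * (‖S (n + 1) i j‖ ^ 2 / (n + 1).choose j) =
      ‖conj z * S n i j + w * S n (i - 1) j‖ ^ 2 / n.choose j := by
    intro j hj
    have hj : j ≤ n := by simpa [Nat.lt_succ_iff] using hj
    have e := cocol_mul_wignerCoeff_succ z (conj z) (w : ℂ) n i j
    have e' := congrArg (fun x : ℂ => ‖x‖ ^ 2) e
    simp only [norm_mul, mul_pow, ← hS] at e'
    have n1 : ‖((n : ℂ) + 1 - (j : ℤ))‖ = n + 1 - j := by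
      rw [show ((n : ℂ) + 1 - (j : ℤ)) = ((n + 1 - j : ℕ) : ℂ) by
        push_cast [show j ≤ n + 1 by omega]; rfl, Complex.norm_natCast]
      push_cast [show j ≤ n + 1 by omega]; rfl
    have n2 : ‖(n + 1 : ℂ)‖ = n + 1 := by
      rw [show (n + 1 : ℂ) = ((n + 1 : ℕ) : ℂ) by push_cast; rfl, Complex.norm_natCast]
      push_cast; rfl
    rw [n1, n2] at e'
    have c : (n.choose j : ℝ) * (n + 1) = (n + 1).choose j * (n + 1 - j) := by
      have := Nat.choose_mul_succ_eq n j
      have := congrArg (Nat.cast : ℕ → ℝ) this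
      push_cast [show j ≤ n + 1 by omega] at this
      exact this
    have p1 : (0 : ℝ) < n.choose j := by exact_mod_cast Nat.choose_pos hj
    have p2 : (0 : ℝ) < (n + 1).choose j := by
      exact_mod_cast Nat.choose_pos (show j ≤ n + 1 by omega)
    have p3 : (n + 1 - j : ℝ) ≠ 0 := by
      have : (j : ℝ) ≤ n := by exact_mod_cast hj
      linarith
    rw [div_mul_div_comm, div_eq_div_iff (by positivity) (by positivity)]
    apply mul_left_cancel₀ p3
    linear_combination (n.choose j : ℝ) * e' +
      (n + 1 : ℝ) * ‖conj z * S n i j + w * S n (i - 1) j‖ ^ 2 * c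
  -- the matrix `!![z, -w; w, conj z]` is unitary
  have hU : ∀ x y : ℂ, ‖z * x - w * y‖ ^ 2 + ‖conj z * y + w * x‖ ^ 2 = ‖x‖ ^ 2 + ‖y‖ ^ 2 := by
    intro x y
    simp only [Complex.sq_norm, Complex.normSq_apply, Complex.add_re, Complex.add_im,
      Complex.sub_re, Complex.sub_im, Complex.mul_re, Complex.mul_im, Complex.conj_re,
      Complex.conj_im, Complex.ofReal_re, Complex.ofReal_im] at h ⊢
    linear_combination (x.re ^ 2 + x.im ^ 2 + y.re ^ 2 + y.im ^ 2) * h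
  have split : ∑ j ∈ Finset.range (n + 2), ‖S (n + 1) i j‖ ^ 2 / (n + 1).choose j =
      ∑ j ∈ Finset.range (n + 2), (j : ℝ) / (n + 1) * (‖S (n + 1) i j‖ ^ 2 / (n + 1).choose j) +
      ∑ j ∈ Finset.range (n + 2),
        ((n : ℝ) + 1 - j) / (n + 1) * (‖S (n + 1) i j‖ ^ 2 / (n + 1).choose j) := by
    rw [← Finset.sum_add_distrib]
    refine Finset.sum_congr rfl fun j _ => ?_
    rw [← add_mul, ← add_div, add_sub_cancel, div_self hn, one_mul]
  rw [split, Finset.sum_range_succ', Finset.sum_range_succ _ (n + 1), Finset.sum_congr rfl hB]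
  push_cast
  rw [Finset.sum_congr rfl fun j _ => hA j, sub_self]
  simp only [zero_div, zero_mul, add_zero]
  rw [← Finset.sum_add_distrib, ← Finset.sum_add_distrib]
  refine Finset.sum_congr rfl fun j _ => ?_
  rw [← add_div, ← add_div, hU]

theorem sum_norm_sq_wignerCoeff {z : ℂ} {w : ℝ} (h : ‖z‖ ^ 2 + w ^ 2 = 1) (n i : ℕ) :
    ∑ j ∈ Finset.range (n + 1), ‖wignerCoeff z (conj z) (w : ℂ) n i j‖ ^ 2 / n.choose j =
      n.choose i := by
  induction n generalizing i with
  | zero =>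
    rcases i with _ | i
    · simp [wignerCoeff_zero]
    · simp [wignerCoeff_zero]
      norm_cast
  | succ n ih =>
    rw [sum_norm_sq_wignerCoeff_succ h]
    rcases i with _ | i
    · rw [ih 0, Finset.sum_eq_zero]
      · simp
      · intro j _
        rw [wignerCoeff_eq_zero _ _ _ (by simp)]
        simp
    · have := ih i
      push_cast
      rw [add_sub_cancel_right, this]
      have := ih (i + 1)
      push_cast at this
      rw [this, Nat.choose_succ_succ]
      push_cast
      ring

/-- A diagonal matrix coefficient of a unitary representation is bounded by one: it is a single
summand in `sum_norm_sq_wignerCoeff`. -/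
theorem norm_diskPoly_le_one {z : ℂ} (hz : ‖z‖ ≤ 1) (a b : ℕ) :
    ‖diskPoly z (conj z) a b‖ ≤ 1 := by
  have hz2 : 0 ≤ 1 - ‖z‖ ^ 2 := by nlinarith [norm_nonneg z]
  have hw : ‖z‖ ^ 2 + √(1 - ‖z‖ ^ 2) ^ 2 = 1 := by rw [Real.sq_sqrt hz2]; ring
  have hw' : z * conj z + ((√(1 - ‖z‖ ^ 2) : ℝ) : ℂ) ^ 2 = 1 := by
    rw [Complex.mul_conj']
    exact_mod_cast hw
  have hC : (0 : ℝ) < (a + b).choose a := by exact_mod_cast Nat.choose_pos (by omega)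
  have h1 := Finset.single_le_sum (f := fun j : ℕ =>
      ‖wignerCoeff z (conj z) ((√(1 - ‖z‖ ^ 2) : ℝ) : ℂ) (a + b) a j‖ ^ 2 / (a + b).choose j)
    (fun j _ => by positivity) (Finset.mem_range.2 (show a < a + b + 1 by omega))
  rw [sum_norm_sq_wignerCoeff hw] at h1
  simp only [wignerCoeff_diag hw', norm_mul, Complex.norm_natCast] at h1
  rw [div_le_iff₀ hC] at h1
  have : ‖diskPoly z (conj z) a b‖ ^ 2 ≤ 1 := by
    have h2 : ((a + b).choose a : ℝ) ^ 2 * ‖diskPoly z (conj z) a b‖ ^ 2 ≤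
      ((a + b).choose a : ℝ) ^ 2 * 1 := by linarith
    exact le_of_mul_le_mul_left h2 (by positivity)
  nlinarith [norm_nonneg (diskPoly z (conj z) a b)]

end UnitaryBound

/-! ### Disk polynomials as functions, and their orthogonality -/

section DiskFunctions

open ComplexConjugate MeasureTheory

/-- The coordinate function `z` on the closed disk. -/
def diskCoord : C(ZDisk, ℂ) := ⟨fun x => (x : ℂ), by fun_prop⟩

/-- The function `conj z` on the closed disk. -/
def diskCoordConj : C(ZDisk, ℂ) := ⟨fun x => conj (x : ℂ), by fun_prop⟩

/-- The function `√(1 - |z|²)` on the closed disk; it completes `z` to the first row of a matrix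
in `SU(2)`. -/
noncomputable def diskCoheight : C(ZDisk, ℂ) :=
  ⟨fun x => ((√(1 - ‖(x : ℂ)‖ ^ 2) : ℝ) : ℂ), by fun_prop⟩

theorem diskCoord_mul_conj_add_sq : diskCoord * diskCoordConj + diskCoheight ^ 2 = 1 := by
  ext x
  have hx : ‖(x : ℂ)‖ ≤ 1 := mem_closedBall_zero_iff.1 x.2
  have hx2 : 0 ≤ 1 - ‖(x : ℂ)‖ ^ 2 := by nlinarith [norm_nonneg (x : ℂ)]
  simp only [diskCoord, diskCoordConj, diskCoheight, ContinuousMap.add_apply,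
    ContinuousMap.mul_apply, ContinuousMap.pow_apply, ContinuousMap.coe_mk,
    ContinuousMap.one_apply]
  rw [Complex.mul_conj', ← Complex.ofReal_pow √_, Real.sq_sqrt hx2]
  push_cast
  ring

/-- The disk polynomials as continuous functions on the closed disk. -/
noncomputable def diskFun (a b : ℕ) : C(ZDisk, ℂ) := diskPoly diskCoord diskCoordConj a b

theorem map_diskPoly {R T : Type*} [CommRing R] [CommRing T] (f : R →+* T) (z zb : R) (a b : ℕ) :
    f (diskPoly z zb a b) = diskPoly (f z) (f zb) a b := by
  simp [diskPoly]

theorem diskFun_apply (a b : ℕ) (x : ZDisk) :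
    diskFun a b x = diskPoly (x : ℂ) (conj (x : ℂ)) a b :=
  map_diskPoly (ContinuousMap.evalAlgHom ℂ ℂ x).toRingHom diskCoord diskCoordConj a b

theorem norm_diskFun_le_one (a b : ℕ) : ‖diskFun a b‖ ≤ 1 := by
  rw [ContinuousMap.norm_le _ zero_le_one]
  intro x
  rw [diskFun_apply]
  exact norm_diskPoly_le_one (mem_closedBall_zero_iff.1 x.2) a b

/-- For `b = 0` the truncated index `b - 1` is harmless, since its coefficient vanishes. -/
theorem diskCoord_mul_diskFun (a b : ℕ) :
    ((a : ℂ) + b + 1) • (diskCoord * diskFun a b) =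
      ((a : ℂ) + 1) • diskFun (a + 1) b + (b : ℂ) • diskFun a (b - 1) := by
  rcases b with _ | b
  · simp [diskFun, diskPoly_zero_right, pow_succ, mul_comm]
  · have := mul_diskPoly diskCoord_mul_conj_add_sq a b
    have e : ∀ (n : ℕ) (f : C(ZDisk, ℂ)), (n : ℂ) • f = (n : C(ZDisk, ℂ)) * f := by
      intro n f; ext; simp
    simp only [diskFun, Nat.add_sub_cancel]
    rw [show (a : ℂ) + (b + 1 : ℕ) + 1 = (a + b + 2 : ℕ) by push_cast; ring,
      show (a : ℂ) + 1 = (a + 1 : ℕ) by push_cast; rfl, e, e, e]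
    push_cast
    exact this

theorem diskCoordConj_mul_diskFun (a b : ℕ) :
    ((a : ℂ) + b + 1) • (diskCoordConj * diskFun a b) =
      ((b : ℂ) + 1) • diskFun a (b + 1) + (a : ℂ) • diskFun (a - 1) b := by
  rcases a with _ | a
  · simp [diskFun, diskPoly_zero_left, pow_succ, mul_comm]
  · have := conj_mul_diskPoly diskCoord_mul_conj_add_sq a b
    have e : ∀ (n : ℕ) (f : C(ZDisk, ℂ)), (n : ℂ) • f = (n : C(ZDisk, ℂ)) * f := by
      intro n f; ext; simp
    simp only [diskFun, Nat.add_sub_cancel]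
    rw [show ((a + 1 : ℕ) : ℂ) + b + 1 = (a + b + 2 : ℕ) by push_cast; ring,
      show (b : ℂ) + 1 = (b + 1 : ℕ) by push_cast; rfl, e, e, e]
    push_cast
    exact this

theorem diskFun_zero_zero : diskFun 0 0 = 1 := by simp [diskFun, diskPoly_zero_left]

/-- A linear functional that vanishes on all nonconstant disk polynomials makes them orthogonal:
the recurrences for `z` and `conj z` reduce the second factor to a constant. Here `diskFun c d` is
the complex conjugate of `diskFun d c`. -/
theorem diskFun_orthogonal (E : C(ZDisk, ℂ) →ₗ[ℂ] ℂ)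
    (hE : ∀ a b, E (diskFun a b) = if a = 0 ∧ b = 0 then 1 else 0) (a b c d : ℕ) :
    E (diskFun a b * diskFun c d) = if a = d ∧ b = c then 1 / ((a : ℂ) + b + 1) else 0 := by
  have pos : ∀ x y : ℕ, (x : ℂ) + y + 1 ≠ 0 := fun x y => by exact_mod_cast Nat.succ_ne_zero (x + y)
  have pos1 : ∀ x : ℕ, (x : ℂ) + 1 ≠ 0 := fun x => by exact_mod_cast Nat.succ_ne_zero x
  induction c generalizing a b d with
  | zero =>
    induction d generalizing a b with
    | zero =>
      rw [diskFun_zero_zero, mul_one, hE]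
      split_ifs with h
      · simp [h.1, h.2]
      · rfl
    | succ d ih =>
      have r := congrArg (fun f => E (f * diskFun 0 d)) (diskCoordConj_mul_diskFun a b)
      have r' : diskFun 0 (d + 1) = diskCoordConj * diskFun 0 d := by
        simp [diskFun, diskPoly_zero_left, pow_succ, mul_comm]
      simp only [add_mul, smul_mul_assoc, map_add, map_smul] at r
      simp only [smul_eq_mul, ih] at r
      rw [r', ← mul_assoc, mul_comm (diskFun a b)]
      apply mul_left_cancel₀ (pos a b)
      rw [r, if_neg (by omega), mul_zero, zero_add]
      rcases a with _ | a
      · simp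
      · simp only [Nat.add_sub_cancel, Nat.add_right_cancel_iff]
        split_ifs with h
        · have := pos a b
          have := pos (a + 1) b
          push_cast at this ⊢
          rw [h.2] at *
          field_simp
          simp
        · simp
  | succ c ih =>
    have r := congrArg (fun f => E (f * diskFun c d)) (diskCoord_mul_diskFun a b)
    have r' := congrArg (fun f => E (diskFun a b * f)) (diskCoord_mul_diskFun c d)
    simp only [add_mul, mul_add, smul_mul_assoc, mul_smul_comm, map_add, map_smul] at r r'
    simp only [smul_eq_mul, ih] at r r'
    rw [mul_left_comm, ← mul_assoc] at r'
    apply mul_left_cancel₀ (pos1 c)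
    apply mul_left_cancel₀ (pos a b)
    have key : ((a : ℂ) + b + 1) * ((c + 1) * E (diskFun a b * diskFun (c + 1) d)) =
        (c + d + 1) * ((a + 1) * (if a + 1 = d ∧ b = c then 1 / (((a + 1 : ℕ) : ℂ) + b + 1) else 0)
          + b * (if a = d ∧ b - 1 = c then 1 / ((a : ℂ) + (b - 1 : ℕ) + 1) else 0))
        - (a + b + 1) * d * (if a = d - 1 ∧ b = c then 1 / ((a : ℂ) + b + 1) else 0) := by
      linear_combination (c + d + 1 : ℂ) * r - (a + b + 1 : ℂ) * r'
    rw [key]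
    by_cases h : a = d ∧ b = c + 1
    · obtain ⟨rfl, rfl⟩ := h
      have h1 := pos a (c + 1)
      have h2 := pos a c
      have h3 := pos c a
      push_cast at h1
      rw [if_neg (by omega), if_pos (by simp), if_neg (by omega), if_pos (by simp)]
      simp only [Nat.add_sub_cancel]
      push_cast
      field_simp
      ring
    · rw [if_neg h]
      have hb : (b : ℂ) * (if a = d ∧ b - 1 = c then 1 / ((a : ℂ) + (b - 1 : ℕ) + 1) else 0) = 0 := by
        rcases b with _ | b
        · simp
        · rw [if_neg (by omega), mul_zero]
      rw [hb, add_zero]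
      rcases d with _ | d
      · simp
      · simp only [Nat.add_right_cancel_iff, Nat.add_sub_cancel]
        split_ifs with h'
        · obtain ⟨rfl, rfl⟩ := h'
          have h1 := pos (a + 1) b
          have h2 := pos a b
          push_cast at h1 ⊢
          field_simp
          ring
        · simp

end DiskFunctions

/-! ### The mean over the disk -/

section DiskMean

open ComplexConjugate MeasureTheory

/-- The parametrization `(t, θ) ↦ √t e^{2πiθ}` of the disk, with `t` clamped to the unit interval
so that it is defined on the plane. It carries Lebesgue measure on the unit square to normalized
area. -/
noncomputable def diskPolar : C(ℝ × ℝ, ZDisk) where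
  toFun p := ⟨(√(Set.projIcc (0 : ℝ) 1 zero_le_one p.1 : ℝ) : ℂ) *
    Complex.exp (((2 * Real.pi * p.2 : ℝ) : ℂ) * Complex.I), by
      rw [mem_closedBall_zero_iff, norm_mul, Complex.norm_exp_ofReal_mul_I, mul_one,
        Complex.norm_real, Real.norm_eq_abs, abs_of_nonneg (Real.sqrt_nonneg _)]
      exact Real.sqrt_le_one.2 (Set.projIcc (0 : ℝ) 1 zero_le_one p.1).2.2⟩
  continuous_toFun := by fun_prop

/-- Lebesgue measure on the unit square. -/
noncomputable def diskPolarMeasure : Measure (ℝ × ℝ) :=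
  (volume.restrict (Set.Ioc 0 1)).prod (volume.restrict (Set.Ioc 0 1))

instance : IsFiniteMeasure diskPolarMeasure := by
  unfold diskPolarMeasure; infer_instance

theorem integrable_comp_diskPolar (f : C(ZDisk, ℂ)) :
    Integrable (fun p => f (diskPolar p)) diskPolarMeasure :=
  Integrable.of_bound (by fun_prop) ‖f‖ (.of_forall fun _ => f.norm_coe_le_norm _)

/-- The mean of a continuous function over the disk. -/
noncomputable def diskMean : C(ZDisk, ℂ) →L[ℂ] ℂ :=
  LinearMap.mkContinuous
    { toFun := fun f => ∫ p, f (diskPolar p) ∂diskPolarMeasure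
      map_add' := fun f g =>
        integral_add (integrable_comp_diskPolar f) (integrable_comp_diskPolar g)
      map_smul' := fun c f => integral_const_mul c _ }
    (diskPolarMeasure.real Set.univ) fun f => by
      refine (norm_integral_le_of_norm_le_const
        (.of_forall fun p => f.norm_coe_le_norm (diskPolar p))).trans ?_
      rw [mul_comm]

theorem diskMean_apply (f : C(ZDisk, ℂ)) :
    diskMean f = ∫ p, f (diskPolar p) ∂diskPolarMeasure := rfl

theorem diskMean_monomial (i j : ℕ) :
    diskMean (diskCoord ^ i * diskCoordConj ^ j) = if i = j then 1 / ((i : ℂ) + 1) else 0 := by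
  have e : ∀ p, (diskCoord ^ i * diskCoordConj ^ j) (diskPolar p) =
      ((√(Set.projIcc (0 : ℝ) 1 zero_le_one p.1 : ℝ) : ℂ)) ^ (i + j) *
        Complex.exp ((2 * Real.pi * ((i : ℂ) - j) * Complex.I) * p.2) := by
    intro p
    simp only [diskCoord, diskCoordConj, diskPolar, ContinuousMap.mul_apply,
      ContinuousMap.pow_apply, ContinuousMap.coe_mk, map_mul, Complex.conj_ofReal,
      ← Complex.exp_conj, Complex.conj_I, mul_pow, ← Complex.exp_nat_mul]
    rw [mul_mul_mul_comm, ← pow_add, ← Complex.exp_add]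
    congr 2
    push_cast
    ring
  rw [diskMean_apply]
  simp only [e]
  rw [diskPolarMeasure, integral_prod_mul (fun t : ℝ =>
      ((√(Set.projIcc (0 : ℝ) 1 zero_le_one t : ℝ) : ℂ)) ^ (i + j))
    (fun t : ℝ => Complex.exp ((2 * Real.pi * ((i : ℂ) - j) * Complex.I) * t)),
    ← intervalIntegral.integral_of_le zero_le_one, ← intervalIntegral.integral_of_le zero_le_one]
  split_ifs with hij
  · subst hij
    have : ∫ t in (0 : ℝ)..1, ((√(Set.projIcc (0 : ℝ) 1 zero_le_one t : ℝ) : ℂ)) ^ (i + i) =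
        ∫ t in (0 : ℝ)..1, ((t ^ i : ℝ) : ℂ) := by
      refine intervalIntegral.integral_congr fun t ht => ?_
      rw [Set.uIcc_of_le zero_le_one] at ht
      rw [Set.projIcc_of_mem zero_le_one ht, ← two_mul, pow_mul, ← Complex.ofReal_pow,
        Real.sq_sqrt ht.1, Complex.ofReal_pow]
    rw [this, intervalIntegral.integral_ofReal, integral_pow]
    simp
  · rw [integral_exp_mul_complex]
    · have : Complex.exp (2 * Real.pi * ((i : ℂ) - j) * Complex.I * (1 : ℝ)) = 1 := by
        rw [Complex.exp_eq_one_iff]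
        exact ⟨(i : ℤ) - j, by push_cast; ring⟩
      rw [this]
      simp
    · have h1 : (i : ℂ) - j ≠ 0 := sub_ne_zero.2 (by exact_mod_cast hij)
      simp [h1, Real.pi_ne_zero]

/-- This is the mean of a radial disk polynomial of positive degree. With `q a b k` the absolute
value of the `k`-th coefficient of `diskPoly a b`, the identity
`(2 n + 1) * q n n k / (n - k + 1) = q (n + 1) n k + q n (n - 1) (k - 1)` for `n = a + 1` turns
the sum into the difference of the values of two disk polynomials at `1`. -/
theorem sum_diskPoly_coeff_div (a : ℕ) :
    ∑ k ∈ Finset.range (a + 2), ((-1 : ℂ) ^ k *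
      (((a + 1) + (a + 1) - k).choose (a + 1) * (a + 1).choose k : ℕ)) *
        (1 / (((a + 1 - k : ℕ) : ℂ) + 1)) = 0 := by
  set T : ℕ → ℂ := fun k => ((-1 : ℂ) ^ k *
      (((a + 1) + (a + 1) - k).choose (a + 1) * (a + 1).choose k : ℕ)) *
        (1 / (((a + 1 - k : ℕ) : ℂ) + 1)) with hT
  have h1 := diskPoly_one_one (R := ℂ) (a + 2) (a + 1)
  have h2 := diskPoly_one_one (R := ℂ) (a + 1) a
  unfold diskPoly at h1 h2
  simp only [one_pow, mul_one] at h1 h2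
  rw [Finset.sum_range_succ, Nat.choose_eq_zero_of_lt (show a + 2 + (a + 1) - (a + 2) < a + 2 by omega)]
    at h1
  rw [Finset.sum_range_succ, Nat.choose_eq_zero_of_lt (show a + 1 + a - (a + 1) < a + 1 by omega)]
    at h2
  simp only [zero_mul, Nat.cast_zero, mul_zero, add_zero] at h1 h2
  have t1 : ∀ k ∈ Finset.range (a + 2), (2 * (a : ℂ) + 3 - k) * T k =
      (-1) ^ k * ((a + 2 + (a + 1) - k).choose (a + 2) * (a + 2).choose k : ℕ) := by
    intro k hk
    have hk : k ≤ a + 1 := by simpa [Nat.lt_succ_iff] using hk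
    obtain ⟨m, hm⟩ := Nat.exists_eq_add_of_le hk
    have c1 := Nat.choose_mul_succ_eq (a + 1) k
    have c2 := Nat.add_one_mul_choose_eq (a + 1 + (a + 1) - k) (a + 1)
    rw [show a + 1 + 1 - k = m + 1 by omega] at c1
    rw [show a + 1 + (a + 1) - k = a + 1 + m by omega] at c2
    simp only [hT]
    rw [show a + 1 + (a + 1) - k = a + 1 + m by omega, show a + 1 - k = m by omega,
      show a + 2 + (a + 1) - k = a + 1 + m + 1 by omega]
    have hm' : (a : ℂ) + 1 = k + m := by exact_mod_cast hm
    have c1 := congrArg (Nat.cast : ℕ → ℂ) c1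
    have c2 := congrArg (Nat.cast : ℕ → ℂ) c2
    push_cast at c1 c2 ⊢
    have hm0 : (m : ℂ) + 1 ≠ 0 := by exact_mod_cast Nat.succ_ne_zero m
    have ha0 : (a : ℂ) + 1 + 1 ≠ 0 := by exact_mod_cast Nat.succ_ne_zero (a + 1)
    have hk' : (k : ℂ) = a + 1 - m := by rw [hm']; ring
    rw [hk']
    field_simp
    linear_combination ((a + 1).choose k : ℂ) * c2 + ((a + 1 + m + 1).choose (a + 2) : ℂ) * c1
  have t2 : ∀ k ∈ Finset.range (a + 1), ((k + 1 : ℕ) : ℂ) * T (k + 1) =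
      -((-1) ^ k * ((a + 1 + a - k).choose (a + 1) * (a + 1).choose k : ℕ)) := by
    intro k hk
    have hk : k ≤ a := by simpa [Nat.lt_succ_iff] using hk
    obtain ⟨m, hm⟩ := Nat.exists_eq_add_of_le hk
    have c1 := Nat.choose_succ_right_eq (a + 1) k
    rw [show a + 1 - k = m + 1 by omega] at c1
    simp only [hT]
    rw [show a + 1 + (a + 1) - (k + 1) = a + 1 + a - k by omega,
      show a + 1 - (k + 1) = m by omega]
    have c1 := congrArg (Nat.cast : ℕ → ℂ) c1
    push_cast at c1 ⊢
    have hm0 : (m : ℂ) + 1 ≠ 0 := by exact_mod_cast Nat.succ_ne_zero m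
    field_simp
    linear_combination -(-1) ^ k * ((a + 1 + a - k).choose (a + 1) : ℂ) * c1
  have s1 := Finset.sum_congr rfl t1
  have s2 := Finset.sum_congr rfl t2
  rw [h1] at s1
  rw [Finset.sum_neg_distrib, h2] at s2
  have s3 : ∑ k ∈ Finset.range (a + 2), (k : ℂ) * T k = -1 := by
    rw [Finset.sum_range_succ', s2]
    simp
  have s4 : (2 * (a : ℂ) + 3) * ∑ k ∈ Finset.range (a + 2), T k = 0 := by
    have := congrArg₂ (· + ·) s1 s3
    simp only [← Finset.sum_add_distrib] at this
    rw [Finset.mul_sum]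
    convert this using 1
    · exact Finset.sum_congr rfl fun k _ => by ring
    · ring
  refine (mul_eq_zero.1 s4).resolve_left ?_
  exact_mod_cast Nat.succ_ne_zero (2 * a + 2)

theorem diskMean_diskFun (a b : ℕ) : diskMean (diskFun a b) = if a = 0 ∧ b = 0 then 1 else 0 := by
  have e : diskMean (diskFun a b) = ∑ k ∈ Finset.range (a + 1),
      ((-1 : ℂ) ^ k * ((a + b - k).choose a * a.choose k : ℕ)) *
        (if a - k = b - k then 1 / (((a - k : ℕ) : ℂ) + 1) else 0) := by
    rw [diskFun, diskPoly, map_sum]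
    refine Finset.sum_congr rfl fun k _ => ?_
    rw [← diskMean_monomial, ← smul_eq_mul (a := (_ : ℂ)) (b := diskMean _),
      ← map_smul diskMean]
    congr 1
  rw [e]
  by_cases hab : a = b
  · subst hab
    rcases a with _ | a
    · simp
    · simp only [if_true]
      rw [if_neg (by omega)]
      exact_mod_cast sum_diskPoly_coeff_div a
  · rw [if_neg (by omega), Finset.sum_eq_zero]
    intro k hk
    have hk : k ≤ a := by simpa [Nat.lt_succ_iff] using hk
    by_cases hkb : k ≤ b
    · rw [if_neg (by omega), mul_zero]
    · rw [Nat.choose_eq_zero_of_lt (by omega)]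
      simp

end DiskMean

/-! ### Comparison with the Zernike functions -/

section ZernikeIndex

open ComplexConjugate

/-- The reindexing of the Zernike functions by `(a, b)`, where `a - b` is the angular index and
`a + b` the degree. -/
def zernikeIndex : ℕ × ℕ ≃ ZIndex where
  toFun p := ⟨((p.1 : ℤ) - p.2, p.1 + p.2), min p.1 p.2, by simp only; omega⟩
  invFun q := (((q.1.2 + q.1.1) / 2).toNat, ((q.1.2 - q.1.1) / 2).toNat)
  left_inv p := by
    ext <;> simp only <;> push_cast <;> omega
  right_inv := by
    rintro ⟨⟨m, n⟩, l, hl⟩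
    ext <;> simp only at hl ⊢ <;> omega

theorem zernikeIndex_degree (p : ℕ × ℕ) : (zernikeIndex p).1.2 = p.1 + p.2 := rfl

theorem zernikeIndex_angular (p : ℕ × ℕ) : (zernikeIndex p).1.1 = (p.1 : ℤ) - p.2 := rfl

theorem zernikeV_zernikeIndex (p : ℕ × ℕ) (z : ℂ) :
    zernikeV (zernikeIndex p).1.1 (zernikeIndex p).1.2 z = diskPoly z (conj z) p.1 p.2 := by
  obtain ⟨a, b⟩ := p
  rw [zernikeIndex_degree, zernikeIndex_angular]
  simp only
  have hsub : ((a + b) - ((a : ℤ) - b).natAbs) / 2 = min a b := by omega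
  have hadd : ((a + b) + ((a : ℤ) - b).natAbs) / 2 = max a b := by omega
  have hfac : ∀ k, (((max a b - k).factorial : ℝ) * ((min a b - k).factorial : ℝ)) =
      ((a - k).factorial : ℝ) * ((b - k).factorial : ℝ) := by
    intro k
    rcases le_total a b with h | h
    · rw [max_eq_right h, min_eq_left h, mul_comm]
    · rw [max_eq_left h, min_eq_right h]
  have hsum : diskPoly z (conj z) a b = ∑ k ∈ Finset.range (min a b + 1),
      (-1) ^ k * ((a + b - k).choose a * a.choose k : ℕ) * (z ^ (a - k) * conj z ^ (b - k)) := by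
    refine (Finset.sum_subset (Finset.range_mono (by omega)) fun k hk hk' => ?_).symm
    simp only [Finset.mem_range, not_lt] at hk hk'
    rw [Nat.choose_eq_zero_of_lt (show a + b - k < a by omega)]
    simp
  rw [hsum, zernikeV, zernikeR, hsub, hadd, Complex.ofReal_sum, Finset.sum_mul]
  refine Finset.sum_congr rfl fun k hk => ?_
  have hk : k ≤ min a b := by simpa [Nat.lt_succ_iff] using hk
  have hka : k ≤ a := hk.trans (min_le_left _ _)
  have hkb : k ≤ b := hk.trans (min_le_right _ _)
  have hcoeff : (-1 : ℝ) ^ k * ((a + b - k).factorial : ℝ) /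
      ((k.factorial : ℝ) * ((max a b - k).factorial : ℝ) * ((min a b - k).factorial : ℝ)) =
      (-1) ^ k * ((a + b - k).choose a * a.choose k : ℕ) := by
    rw [mul_assoc, hfac]
    push_cast
    rw [Nat.cast_choose ℝ (show a ≤ a + b - k by omega), Nat.cast_choose ℝ hka,
      show a + b - k - a = b - k by omega]
    have := Nat.factorial_pos a
    field_simp
  have hpow : z ^ (a - k) * conj z ^ (b - k) = ((‖z‖ ^ (a + b - 2 * k) : ℝ) : ℂ) *
      Complex.exp (Complex.I * (((a : ℤ) - b : ℤ) : ℂ) * (Complex.arg z : ℂ)) := by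
    have e : z ^ (a - k) * conj z ^ (b - k) =
      (‖z‖ * Complex.exp (Complex.arg z * Complex.I)) ^ (a - k) *
        conj (‖z‖ * Complex.exp (Complex.arg z * Complex.I)) ^ (b - k) := by
      rw [Complex.norm_mul_exp_arg_mul_I]
    rw [e]
    simp only [map_mul, Complex.conj_ofReal, ← Complex.exp_conj, Complex.conj_I, mul_pow,
      ← Complex.exp_nat_mul]
    rw [mul_mul_mul_comm, ← pow_add, ← Complex.exp_add, show a - k + (b - k) = a + b - 2 * k by omega]
    push_cast [hka, hkb]
    congr 2
    ring
  rw [hcoeff, hpow]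
  push_cast
  ring

theorem hasSum_zernike_iff (c : ZIndex → ℂ) (x : ZDisk) (s : ℂ) :
    HasSum (fun p : ZIndex => c p * zernikeV p.1.1 p.1.2 (x : ℂ)) s ↔
      HasSum (fun p : ℕ × ℕ => c (zernikeIndex p) * diskFun p.1 p.2 x) s := by
  rw [← zernikeIndex.hasSum_iff]
  simp only [Function.comp_def, zernikeV_zernikeIndex, diskFun_apply]

theorem summable_zernike_iff (ρ : ℝ) (c : ZIndex → ℂ) :
    ZernikeSummable ρ c ↔ Summable fun p : ℕ × ℕ => abs₁ (c (zernikeIndex p)) * ρ ^ (p.1 + p.2) := by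
  rw [ZernikeSummable, ← zernikeIndex.summable_iff]
  rfl

theorem zernikeNorm_eq (ρ : ℝ) (c : ZIndex → ℂ) :
    zernikeNorm ρ c = ∑' p : ℕ × ℕ, abs₁ (c (zernikeIndex p)) * ρ ^ (p.1 + p.2) := by
  rw [zernikeNorm, ← zernikeIndex.tsum_eq]
  rfl

end ZernikeIndex

/-! ### Series of disk polynomials -/

section DiskSeries

open ComplexConjugate

theorem norm_le_abs₁ (w : ℂ) : ‖w‖ ≤ abs₁ w := Complex.norm_le_abs_re_add_abs_im w

theorem abs₁_mul_le (v w : ℂ) : abs₁ (v * w) ≤ abs₁ v * abs₁ w := by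
  simp only [abs₁, Complex.mul_re, Complex.mul_im]
  have h1 := abs_sub (v.re * w.re) (v.im * w.im)
  have h2 := abs_add_le (v.re * w.im) (v.im * w.re)
  simp only [abs_mul] at h1 h2
  linarith

theorem abs₁_mul_ofReal (w : ℂ) {r : ℝ} (hr : 0 ≤ r) : abs₁ (w * r) = abs₁ w * r := by
  rw [mul_comm, ← Complex.real_smul, abs₁_smul, abs_of_nonneg hr, mul_comm]

theorem summable_of_summable_abs₁ {ι : Type*} {f : ι → ℂ} (hf : Summable fun i => abs₁ (f i)) :
    Summable f :=
  Summable.of_norm_bounded hf fun i => norm_le_abs₁ (f i)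

theorem abs₁_tsum_le {ι : Type*} {f : ι → ℂ} (hf : Summable fun i => abs₁ (f i)) :
    abs₁ (∑' i, f i) ≤ ∑' i, abs₁ (f i) := by
  have hs := summable_of_summable_abs₁ hf
  have hre : Summable fun i => |(f i).re| :=
    Summable.of_nonneg_of_le (fun _ => abs_nonneg _)
      (fun i => le_add_of_nonneg_right (abs_nonneg (f i).im)) hf
  have him : Summable fun i => |(f i).im| :=
    Summable.of_nonneg_of_le (fun _ => abs_nonneg _)
      (fun i => le_add_of_nonneg_left (abs_nonneg (f i).re)) hf
  unfold abs₁
  rw [Complex.re_tsum hs, Complex.im_tsum hs, hre.tsum_add him]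
  have h1 := norm_tsum_le_tsum_norm (f := fun i => (f i).re) hre
  have h2 := norm_tsum_le_tsum_norm (f := fun i => (f i).im) him
  simp only [Real.norm_eq_abs] at h1 h2
  exact add_le_add h1 h2

/-- Finiteness of the weighted norm, for families indexed by `(a, b)`. -/
def DiskSummable (ρ : ℝ) (c : ℕ × ℕ → ℂ) : Prop :=
  Summable fun p : ℕ × ℕ => abs₁ (c p) * ρ ^ (p.1 + p.2)

/-- The sum of the series of disk functions with coefficients `c`, taken in the Banach space of
continuous functions on the disk. -/
noncomputable def diskSeries (c : ℕ × ℕ → ℂ) : C(ZDisk, ℂ) := ∑' p, c p • diskFun p.1 p.2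

variable {ρ : ℝ}

theorem norm_smul_diskFun_le (hρ : 1 ≤ ρ) (v : ℂ) (p : ℕ × ℕ) :
    ‖v • diskFun p.1 p.2‖ ≤ abs₁ v * ρ ^ (p.1 + p.2) := by
  rw [norm_smul]
  exact mul_le_mul (norm_le_abs₁ v)
    ((norm_diskFun_le_one _ _).trans (one_le_pow₀ hρ)) (norm_nonneg _) (abs₁_nonneg _)

theorem DiskSummable.summable_norm (hρ : 1 ≤ ρ) {c : ℕ × ℕ → ℂ} (hc : DiskSummable ρ c) :
    Summable fun p => ‖c p • diskFun p.1 p.2‖ :=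
  Summable.of_nonneg_of_le (fun _ => norm_nonneg _) (fun p => norm_smul_diskFun_le hρ (c p) p) hc

theorem DiskSummable.hasSum (hρ : 1 ≤ ρ) {c : ℕ × ℕ → ℂ} (hc : DiskSummable ρ c) :
    HasSum (fun p => c p • diskFun p.1 p.2) (diskSeries c) :=
  (hc.summable_norm hρ).of_norm.hasSum

theorem DiskSummable.hasSum_apply (hρ : 1 ≤ ρ) {c : ℕ × ℕ → ℂ} (hc : DiskSummable ρ c)
    (x : ZDisk) : HasSum (fun p => c p * diskFun p.1 p.2 x) (diskSeries c x) :=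
  (hc.hasSum hρ).map (ContinuousMap.evalCLM ℂ x) (ContinuousMap.evalCLM ℂ x).continuous

/-- The coefficients of a series are recovered from its sum by orthogonality. -/
theorem diskMean_diskSeries_mul (hρ : 1 ≤ ρ) {c : ℕ × ℕ → ℂ} (hc : DiskSummable ρ c) (a b : ℕ) :
    diskMean (diskSeries c * diskFun b a) = c (a, b) * (1 / ((a : ℂ) + b + 1)) := by
  have h := ((hc.hasSum hρ).mul_right (diskFun b a)).map diskMean diskMean.continuous
  refine h.unique ?_
  have e : ∀ p : ℕ × ℕ, (diskMean ∘ fun p : ℕ × ℕ => c p • diskFun p.1 p.2 * diskFun b a) p =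
      if p = (a, b) then c (a, b) * (1 / ((a : ℂ) + b + 1)) else 0 := by
    rintro ⟨x, y⟩
    simp only [Function.comp_apply, smul_mul_assoc, map_smul, smul_eq_mul]
    rw [show diskMean (diskFun x y * diskFun b a) = _ from
      diskFun_orthogonal (diskMean : C(ZDisk, ℂ) →ₗ[ℂ] ℂ) diskMean_diskFun x y b a]
    simp only [Prod.mk.injEq]
    split_ifs with h
    · rw [h.1, h.2]
    · simp
  rw [funext e]
  exact hasSum_ite_eq (a, b) _

theorem diskSeries_injective (hρ : 1 ≤ ρ) {c d : ℕ × ℕ → ℂ} (hc : DiskSummable ρ c)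
    (hd : DiskSummable ρ d) (h : diskSeries c = diskSeries d) : c = d := by
  funext ⟨a, b⟩
  have e := diskMean_diskSeries_mul hρ hc a b
  rw [h, diskMean_diskSeries_mul hρ hd a b] at e
  have : (1 / ((a : ℂ) + b + 1)) ≠ 0 :=
    one_div_ne_zero (by exact_mod_cast Nat.succ_ne_zero (a + b))
  exact (mul_right_cancel₀ this e).symm

theorem diskFun_apply_one (a b : ℕ) : diskFun a b ⟨1, by simp⟩ = 1 := by
  rw [diskFun_apply]
  simpa using diskPoly_one_one (R := ℂ) a b

/-- A product of two disk functions is a convex combination of disk functions of at most the sum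
of the degrees. The weights sum to one because all disk functions take the value `1` at `1`. -/
theorem exists_linearization (p q : ℕ × ℕ) :
    ∃ L : ℕ × ℕ →₀ ℝ≥0, (∀ r ∈ L.support, r.1 + r.2 ≤ (p.1 + p.2) + (q.1 + q.2)) ∧
      ∑ r ∈ L.support, (L r : ℝ) = 1 ∧
      diskFun p.1 p.2 * diskFun q.1 q.2 =
        ∑ r ∈ L.support, ((L r : ℝ) : ℂ) • diskFun r.1 r.2 := by
  have h := diskPoly_mul_mem_diskCone diskCoord_mul_conj_add_sq p.1 p.2 q.1 q.2
  rw [diskCone, Finsupp.mem_span_image_iff_linearCombination] at h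
  obtain ⟨L, hL, e⟩ := h
  have e' : diskFun p.1 p.2 * diskFun q.1 q.2 =
      ∑ r ∈ L.support, ((L r : ℝ) : ℂ) • diskFun r.1 r.2 := by
    rw [diskFun, diskFun, ← e, Finsupp.linearCombination_apply, Finsupp.sum]
    refine Finset.sum_congr rfl fun r _ => ?_
    ext x
    simp only [ContinuousMap.smul_apply, diskFun, smul_eq_mul, NNReal.smul_def, Complex.real_smul]
  refine ⟨L, fun r hr => (Finsupp.mem_supported _ _).1 hL hr, ?_, e'⟩
  have := congrArg (fun f : C(ZDisk, ℂ) => f ⟨1, by simp⟩) e'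
  simp only [ContinuousMap.mul_apply, ContinuousMap.coe_sum, Finset.sum_apply,
    ContinuousMap.smul_apply, diskFun_apply_one, smul_eq_mul, mul_one] at this
  exact_mod_cast this.symm

/-- Series of finite weighted norm multiply to such a series, and the norm is submultiplicative:
by `exists_linearization`, a product of two disk functions has at most the product of their
weights. -/
theorem DiskSummable.exists_mul (hρ : 1 ≤ ρ) {c d : ℕ × ℕ → ℂ} (hc : DiskSummable ρ c)
    (hd : DiskSummable ρ d) :
    ∃ e : ℕ × ℕ → ℂ, DiskSummable ρ e ∧ diskSeries e = diskSeries c * diskSeries d ∧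
      ∑' p, abs₁ (e p) * ρ ^ (p.1 + p.2) ≤
        (∑' p, abs₁ (c p) * ρ ^ (p.1 + p.2)) * ∑' p, abs₁ (d p) * ρ ^ (p.1 + p.2) := by
  have hρ0 : 0 ≤ ρ := zero_le_one.trans hρ
  choose L hLdeg hLsum hLmul using exists_linearization
  set t : (ℕ × ℕ) × (ℕ × ℕ) → ℕ × ℕ → ℂ := fun pq r => c pq.1 * d pq.2 * (L pq.1 pq.2 r : ℝ) with ht
  set g : ((ℕ × ℕ) × (ℕ × ℕ)) × (ℕ × ℕ) → ℝ :=
    fun x => abs₁ (t x.1 x.2) * ρ ^ (x.2.1 + x.2.2) with hg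
  have hg0 : ∀ x, 0 ≤ g x := fun x => mul_nonneg (abs₁_nonneg _) (by positivity)
  have ht0 : ∀ pq, ∀ r ∉ (L pq.1 pq.2).support, t pq r = 0 := by
    intro pq r hr
    simp [ht, Finsupp.notMem_support_iff.1 hr]
  have hg0' : ∀ pq, ∀ r ∉ (L pq.1 pq.2).support, g (pq, r) = 0 := by
    intro pq r hr
    simp [hg, ht0 pq r hr, abs₁]
  set M : (ℕ × ℕ) × (ℕ × ℕ) → ℝ := fun pq =>
    (abs₁ (c pq.1) * ρ ^ (pq.1.1 + pq.1.2)) * (abs₁ (d pq.2) * ρ ^ (pq.2.1 + pq.2.2)) with hM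
  have hMs : Summable M := Summable.mul_of_nonneg hc hd
    (fun p => mul_nonneg (abs₁_nonneg _) (by positivity))
    (fun p => mul_nonneg (abs₁_nonneg _) (by positivity))
  have hinner : ∀ pq, ∑' r, g (pq, r) ≤ M pq := by
    intro pq
    rw [tsum_eq_sum fun r hr => hg0' pq r hr]
    calc ∑ r ∈ (L pq.1 pq.2).support, g (pq, r)
        ≤ ∑ r ∈ (L pq.1 pq.2).support, M pq * (L pq.1 pq.2 r : ℝ) := by
          refine Finset.sum_le_sum fun r hr => ?_
          simp only [hg, ht, hM]
          rw [abs₁_mul_ofReal _ (NNReal.coe_nonneg _)]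
          have h1 := abs₁_mul_le (c pq.1) (d pq.2)
          have h2 : ρ ^ (r.1 + r.2) ≤ ρ ^ (pq.1.1 + pq.1.2) * ρ ^ (pq.2.1 + pq.2.2) := by
            rw [← pow_add]
            exact pow_le_pow_right₀ hρ (hLdeg _ _ r hr)
          have h3 : (0 : ℝ) ≤ L pq.1 pq.2 r := NNReal.coe_nonneg _
          calc abs₁ (c pq.1 * d pq.2) * (L pq.1 pq.2 r : ℝ) * ρ ^ (r.1 + r.2)
              = abs₁ (c pq.1 * d pq.2) * ρ ^ (r.1 + r.2) * (L pq.1 pq.2 r : ℝ) := by ring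
            _ ≤ (abs₁ (c pq.1) * abs₁ (d pq.2)) *
                  (ρ ^ (pq.1.1 + pq.1.2) * ρ ^ (pq.2.1 + pq.2.2)) * (L pq.1 pq.2 r : ℝ) := by
                refine mul_le_mul_of_nonneg_right (mul_le_mul h1 h2 (by positivity) ?_) h3
                exact mul_nonneg (abs₁_nonneg _) (abs₁_nonneg _)
            _ = _ := by ring
      _ = M pq := by rw [← Finset.mul_sum, hLsum, mul_one]
  have hgs : Summable g := by
    rw [summable_prod_of_nonneg hg0]
    refine ⟨fun pq => summable_of_ne_finset_zero (s := (L pq.1 pq.2).support)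
      fun r hr => hg0' pq r hr, ?_⟩
    exact Summable.of_nonneg_of_le (fun pq => tsum_nonneg fun r => hg0 _) hinner hMs
  have hgs' : Summable fun x : (ℕ × ℕ) × ((ℕ × ℕ) × (ℕ × ℕ)) => g (x.2, x.1) := hgs.prod_symm
  have hts : ∀ r, Summable fun pq => abs₁ (t pq r) := by
    intro r
    refine Summable.of_nonneg_of_le (fun _ => abs₁_nonneg _) (fun pq => ?_) (hgs'.prod_factor r)
    exact le_mul_of_one_le_right (abs₁_nonneg _) (one_le_pow₀ hρ)
  have hle : ∀ r : ℕ × ℕ, abs₁ (∑' pq, t pq r) * ρ ^ (r.1 + r.2) ≤ ∑' pq, g (pq, r) := by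
    intro r
    simp only [hg]
    rw [tsum_mul_right]
    exact mul_le_mul_of_nonneg_right (abs₁_tsum_le (hts r)) (by positivity)
  have hes : DiskSummable ρ fun r => ∑' pq, t pq r :=
    Summable.of_nonneg_of_le (fun r => mul_nonneg (abs₁_nonneg _) (by positivity)) hle hgs'.prod
  refine ⟨fun r => ∑' pq, t pq r, hes, ?_, ?_⟩
  · have hF : Summable fun x : ((ℕ × ℕ) × (ℕ × ℕ)) × (ℕ × ℕ) =>
        t x.1 x.2 • diskFun x.2.1 x.2.2 :=
      Summable.of_norm_bounded hgs fun x => norm_smul_diskFun_le hρ _ _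
    calc diskSeries (fun r => ∑' pq, t pq r)
        = ∑' r, ∑' pq, t pq r • diskFun r.1 r.2 := by
          refine tsum_congr fun r => ?_
          exact ((summable_of_summable_abs₁ (hts r)).tsum_smul_const _).symm
      _ = ∑' pq, ∑' r, t pq r • diskFun r.1 r.2 := Summable.tsum_comm hF
      _ = ∑' pq : (ℕ × ℕ) × (ℕ × ℕ),
            (c pq.1 • diskFun pq.1.1 pq.1.2) * (d pq.2 • diskFun pq.2.1 pq.2.2) := by
          refine tsum_congr fun pq => ?_
          rw [tsum_eq_sum (s := (L pq.1 pq.2).support) fun r hr => by rw [ht0 pq r hr, zero_smul],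
            smul_mul_smul_comm, hLmul, Finset.smul_sum]
          exact Finset.sum_congr rfl fun r _ => by simp only [ht, mul_smul]
      _ = diskSeries c * diskSeries d :=
          (tsum_mul_tsum_of_summable_norm (hc.summable_norm hρ) (hd.summable_norm hρ)).symm
  · calc ∑' r : ℕ × ℕ, abs₁ (∑' pq, t pq r) * ρ ^ (r.1 + r.2)
        ≤ ∑' r, ∑' pq, g (pq, r) := hes.tsum_le_tsum hle hgs'.prod
      _ = ∑' pq, ∑' r, g (pq, r) := Summable.tsum_comm hgs
      _ ≤ ∑' pq, M pq := hgs.prod.tsum_le_tsum hinner hMs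
      _ = _ := (Summable.tsum_mul_tsum hc hd hMs).symm

end DiskSeries

/-! ### The Banach algebra -/

section ZernikeAlgebra

variable {ρ : NNReal} {c d : ZIndex → ℂ} {u v : ZDisk → ℂ}

theorem diskSummable_comp_iff :
    DiskSummable ρ (c ∘ zernikeIndex) ↔ ZernikeSummable ρ c :=
  (summable_zernike_iff ρ c).symm

theorem isZernikeExpansion_iff (hρ : 1 ≤ ρ) :
    IsZernikeExpansion ρ c u ↔ ZernikeSummable ρ c ∧ u = diskSeries (c ∘ zernikeIndex) := by
  refine and_congr_right fun hc => ?_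
  have h := DiskSummable.hasSum_apply (by exact_mod_cast hρ) (diskSummable_comp_iff.2 hc)
  simp only [hasSum_zernike_iff]
  refine ⟨fun hu => funext fun x => (hu x).unique (h x), ?_⟩
  rintro rfl x
  exact h x

theorem IsZernikeExpansion.unique (hρ : 1 ≤ ρ) (hc : IsZernikeExpansion ρ c u)
    (hd : IsZernikeExpansion ρ d u) : c = d := by
  obtain ⟨hc, hcu⟩ := (isZernikeExpansion_iff hρ).1 hc
  obtain ⟨hd, hdu⟩ := (isZernikeExpansion_iff hρ).1 hd
  have := diskSeries_injective (by exact_mod_cast hρ) (diskSummable_comp_iff.2 hc)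
    (diskSummable_comp_iff.2 hd) (DFunLike.coe_injective (hcu.symm.trans hdu))
  exact zernikeIndex.surjective.injective_comp_right this

theorem IsZernikeExpansion.add (hc : IsZernikeExpansion ρ c u) (hd : IsZernikeExpansion ρ d v) :
    IsZernikeExpansion ρ (c + d) (u + v) := by
  refine ⟨?_, fun x => ?_⟩
  · refine Summable.of_nonneg_of_le (fun p => mul_nonneg (abs₁_nonneg _) (by positivity))
      (fun p => ?_) (hc.1.add hd.1)
    rw [← add_mul]
    exact mul_le_mul_of_nonneg_right (abs₁_add_le _ _) (by positivity)
  · simpa [add_mul] using (hc.2 x).add (hd.2 x)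

theorem IsZernikeExpansion.smul (a : ℝ) (hc : IsZernikeExpansion ρ c u) :
    IsZernikeExpansion ρ (a • c) (a • u) := by
  refine ⟨?_, fun x => ?_⟩
  · refine (hc.1.mul_left |a|).congr fun p => ?_
    rw [Pi.smul_apply, abs₁_smul, mul_assoc]
  · simpa [mul_assoc] using (hc.2 x).mul_left (a : ℂ)

theorem IsZernikeExpansion.sub (hc : IsZernikeExpansion ρ c u) (hd : IsZernikeExpansion ρ d v) :
    IsZernikeExpansion ρ (c - d) (u - v) := by
  simpa [sub_eq_add_neg] using hc.add (hd.smul (-1))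

theorem isZernikeExpansion_zero : IsZernikeExpansion ρ 0 0 :=
  ⟨by simp [ZernikeSummable, abs₁], fun x => by simp⟩

theorem zernikeNorm_add_le (hc : ZernikeSummable ρ c) (hd : ZernikeSummable ρ d) :
    zernikeNorm ρ (c + d) ≤ zernikeNorm ρ c + zernikeNorm ρ d := by
  have hle : ∀ p : ZIndex, abs₁ ((c + d) p) * (ρ : ℝ) ^ p.1.2 ≤
      abs₁ (c p) * (ρ : ℝ) ^ p.1.2 + abs₁ (d p) * (ρ : ℝ) ^ p.1.2 := by
    intro p
    rw [← add_mul]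
    exact mul_le_mul_of_nonneg_right (abs₁_add_le _ _) (by positivity)
  have hs : ZernikeSummable ρ (c + d) :=
    Summable.of_nonneg_of_le (fun p => mul_nonneg (abs₁_nonneg _) (by positivity)) hle (hc.add hd)
  exact (hs.tsum_le_tsum hle (hc.add hd)).trans_eq (hc.tsum_add hd)

theorem zernikeNorm_smul (a : ℝ) (c : ZIndex → ℂ) :
    zernikeNorm ρ (a • c) = |a| * zernikeNorm ρ c := by
  simp only [zernikeNorm, Pi.smul_apply, abs₁_smul, mul_assoc, tsum_mul_left]

theorem eq_zero_of_zernikeNorm_eq_zero (hρ : 1 ≤ ρ) (hc : ZernikeSummable ρ c)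
    (h : zernikeNorm ρ c = 0) : c = 0 := by
  have hρ0 : (0 : ℝ) < ρ := by exact_mod_cast zero_lt_one.trans_le hρ
  have hnn : ∀ p : ZIndex, 0 ≤ abs₁ (c p) * (ρ : ℝ) ^ p.1.2 :=
    fun p => mul_nonneg (abs₁_nonneg _) (by positivity)
  have hsum : HasSum (fun p : ZIndex => abs₁ (c p) * (ρ : ℝ) ^ p.1.2) 0 := by
    rw [← h]
    exact hc.hasSum
  have h0 := (hasSum_zero_iff_of_nonneg hnn).1 hsum
  funext p
  have hp := congrFun h0 p
  simp only [Pi.zero_apply, mul_eq_zero, (pow_pos hρ0 _).ne', or_false] at hp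
  have := norm_le_abs₁ (c p)
  rw [hp] at this
  exact norm_le_zero_iff.1 this

theorem IsZernikeExpansion.exists_mul (hρ : 1 ≤ ρ) (hc : IsZernikeExpansion ρ c u)
    (hd : IsZernikeExpansion ρ d v) :
    ∃ e, IsZernikeExpansion ρ e (u * v) ∧
      zernikeNorm ρ e ≤ zernikeNorm ρ c * zernikeNorm ρ d := by
  obtain ⟨hcs, rfl⟩ := (isZernikeExpansion_iff hρ).1 hc
  obtain ⟨hds, rfl⟩ := (isZernikeExpansion_iff hρ).1 hd
  obtain ⟨e, he, hmul, hle⟩ := DiskSummable.exists_mul (by exact_mod_cast hρ)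
    (diskSummable_comp_iff.2 hcs) (diskSummable_comp_iff.2 hds)
  have e' : (e ∘ zernikeIndex.symm) ∘ zernikeIndex = e := by
    simp [Function.comp_assoc]
  refine ⟨e ∘ zernikeIndex.symm, (isZernikeExpansion_iff hρ).2
    ⟨diskSummable_comp_iff.1 (by rwa [e']), ?_⟩, ?_⟩
  · rw [e', hmul, ContinuousMap.coe_mul]
  · rw [zernikeNorm_eq, zernikeNorm_eq, zernikeNorm_eq]
    simpa using hle

theorem one_mem_zernikeSpace (hρ : 1 ≤ ρ) : (1 : ZDisk → ℂ) ∈ zernikeSpace ρ := by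
  refine ⟨(Pi.single (0, 0) 1) ∘ zernikeIndex.symm, (isZernikeExpansion_iff hρ).2 ⟨?_, ?_⟩⟩
  · rw [← diskSummable_comp_iff]
    refine summable_of_ne_finset_zero (s := {(0, 0)}) fun p hp => ?_
    simp [Pi.single_eq_of_ne (show p ≠ (0, 0) by simpa using hp), abs₁]
  · rw [Function.comp_assoc, Equiv.symm_comp_self, Function.comp_id, diskSeries,
      tsum_eq_single (0, 0) fun p hp => by simp [Pi.single_eq_of_ne hp]]
    simp [diskFun_zero_zero]

/-- The Zernike space as an algebra under pointwise multiplication. -/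
noncomputable def zernikeAlgebra (hρ : 1 ≤ ρ) : Subalgebra ℝ (ZDisk → ℂ) :=
  (zernikeSpace ρ).toSubalgebra (one_mem_zernikeSpace hρ) fun _ _ ⟨_, hc⟩ ⟨_, hd⟩ =>
    (hc.exists_mul hρ hd).imp fun _ he => he.1

/-- The Zernike coefficients of a function in the Zernike algebra. -/
noncomputable def zernikeCoeff (hρ : 1 ≤ ρ) (u : zernikeAlgebra hρ) : ZIndex → ℂ :=
  Classical.choose (show (u : ZDisk → ℂ) ∈ zernikeSpace ρ from u.2)

theorem isZernikeExpansion_zernikeCoeff (hρ : 1 ≤ ρ) (u : zernikeAlgebra hρ) :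
    IsZernikeExpansion ρ (zernikeCoeff hρ u) u :=
  Classical.choose_spec (show (u : ZDisk → ℂ) ∈ zernikeSpace ρ from u.2)

theorem zernikeCoeff_eq (hρ : 1 ≤ ρ) {u : zernikeAlgebra hρ} (hc : IsZernikeExpansion ρ c u) :
    zernikeCoeff hρ u = c :=
  (isZernikeExpansion_zernikeCoeff hρ u).unique hρ hc

/-- The weighted `ℓ¹` norm of the Zernike coefficients, as an algebra norm. -/
noncomputable def zernikeAlgebraNorm (hρ : 1 ≤ ρ) : AlgebraNorm ℝ (zernikeAlgebra hρ) where
  toFun u := zernikeNorm ρ (zernikeCoeff hρ u)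
  map_zero' := by
    rw [zernikeCoeff_eq hρ (isZernikeExpansion_zero (ρ := ρ))]
    simp [zernikeNorm, abs₁]
  add_le' u v := by
    have hu := isZernikeExpansion_zernikeCoeff hρ u
    have hv := isZernikeExpansion_zernikeCoeff hρ v
    rw [zernikeCoeff_eq hρ (u := u + v) (hu.add hv)]
    exact zernikeNorm_add_le hu.1 hv.1
  neg' u := by
    have hu := (isZernikeExpansion_zernikeCoeff hρ u).smul (-1)
    rw [neg_one_smul ℝ (u : ZDisk → ℂ)] at hu
    rw [zernikeCoeff_eq hρ (u := -u) hu, zernikeNorm_smul]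
    simp
  smul' a u := by
    have hu := (isZernikeExpansion_zernikeCoeff hρ u).smul a
    rw [zernikeCoeff_eq hρ (u := a • u) hu, zernikeNorm_smul, Real.norm_eq_abs]
  mul_le' u v := by
    obtain ⟨e, he, hle⟩ := (isZernikeExpansion_zernikeCoeff hρ u).exists_mul hρ
      (isZernikeExpansion_zernikeCoeff hρ v)
    rw [zernikeCoeff_eq hρ (u := u * v) he]
    exact hle
  eq_zero_of_map_eq_zero' u h := by
    have hu := isZernikeExpansion_zernikeCoeff hρ u
    rw [eq_zero_of_zernikeNorm_eq_zero hρ hu.1 h] at hu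
    refine Subtype.ext (funext fun x => (hu.2 x).unique ?_)
    simp

theorem zernikeAlgebraNorm_apply (hρ : 1 ≤ ρ) (u : zernikeAlgebra hρ) :
    zernikeAlgebraNorm hρ u = zernikeNorm ρ (zernikeCoeff hρ u) := rfl

/-- The family `c p * ρ ^ n`, with values in the plane with the norm `|x| + |y|`; its `ℓ¹` norm is
the weighted norm of `c`. -/
noncomputable def weightedCoeff (ρ : NNReal) (c : ZIndex → ℂ) (p : ZIndex) : WithLp 1 (ℝ × ℝ) :=
  WithLp.toLp 1 ((c p).re * ρ ^ p.1.2, (c p).im * ρ ^ p.1.2)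

theorem norm_weightedCoeff (c : ZIndex → ℂ) (p : ZIndex) :
    ‖weightedCoeff ρ c p‖ = abs₁ (c p) * ρ ^ p.1.2 := by
  simp [weightedCoeff, WithLp.prod_norm_eq_of_L1, abs₁, add_mul]

theorem memℓp_weightedCoeff_iff : Memℓp (weightedCoeff ρ c) 1 ↔ ZernikeSummable ρ c := by
  rw [memℓp_gen_iff (by simp)]
  simp [norm_weightedCoeff, ZernikeSummable]

/-- The isometry of the Zernike algebra onto an `ℓ¹` space, from which it inherits completeness.
-/
noncomputable def zernikeIsometryFun (hρ : 1 ≤ ρ) (u : zernikeAlgebra hρ) :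
    lp (fun _ : ZIndex => WithLp 1 (ℝ × ℝ)) 1 :=
  ⟨weightedCoeff ρ (zernikeCoeff hρ u),
    memℓp_weightedCoeff_iff.2 (isZernikeExpansion_zernikeCoeff hρ u).1⟩

theorem norm_zernikeIsometryFun_sub (hρ : 1 ≤ ρ) (u v : zernikeAlgebra hρ) :
    ‖zernikeIsometryFun hρ u - zernikeIsometryFun hρ v‖ = zernikeAlgebraNorm hρ (u - v) := by
  have h := (isZernikeExpansion_zernikeCoeff hρ u).sub (isZernikeExpansion_zernikeCoeff hρ v)
  rw [lp.norm_eq_tsum_rpow (by simp), zernikeAlgebraNorm_apply, zernikeCoeff_eq hρ (u := u - v) h]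
  simp only [ENNReal.toReal_one, Real.rpow_one, div_one, zernikeNorm]
  refine tsum_congr fun p => ?_
  rw [← norm_weightedCoeff]
  congr 1
  change weightedCoeff ρ (zernikeCoeff hρ u) p - weightedCoeff ρ (zernikeCoeff hρ v) p = _
  simp [weightedCoeff, sub_mul, ← WithLp.toLp_sub]

theorem zernikeIsometryFun_surjective (hρ : 1 ≤ ρ) :
    Function.Surjective (zernikeIsometryFun hρ) := by
  intro f
  have hρ0 : (ρ : ℝ) ≠ 0 := by exact_mod_cast (zero_lt_one.trans_le hρ).ne'
  set c : ZIndex → ℂ := fun p => ⟨(f p).fst / ρ ^ p.1.2, (f p).snd / ρ ^ p.1.2⟩ with hc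
  have hcf : weightedCoeff ρ c = f := by
    funext p
    apply (WithLp.ofLp_injective 1)
    simp [weightedCoeff, hc, hρ0]
    rfl
  have hs : ZernikeSummable ρ c := by
    rw [← memℓp_weightedCoeff_iff, hcf]
    exact f.2
  have he := (isZernikeExpansion_iff hρ).2 ⟨hs, rfl⟩
  refine ⟨⟨_, c, he⟩, Subtype.ext ?_⟩
  rw [← hcf]
  exact congrArg (weightedCoeff ρ) (zernikeCoeff_eq hρ he)

theorem completeSpace_zernikeAlgebra (hρ : 1 ≤ ρ) :
    @CompleteSpace (zernikeAlgebra hρ)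
      (zernikeAlgebraNorm hρ).toRingNorm.toNormedRing.toMetricSpace.toPseudoMetricSpace.toUniformSpace := by
  let _ : NormedRing (zernikeAlgebra hρ) := (zernikeAlgebraNorm hρ).toRingNorm.toNormedRing
  have hiso : Isometry (zernikeIsometryFun hρ) := Isometry.of_dist_eq fun u v => by
    rw [dist_eq_norm, norm_zernikeIsometryFun_sub]
    exact (dist_eq_norm u v).symm
  let e : zernikeAlgebra hρ ≃ᵢ lp (fun _ : ZIndex => WithLp 1 (ℝ × ℝ)) 1 :=
    { Equiv.ofBijective _ ⟨hiso.injective, zernikeIsometryFun_surjective hρ⟩ with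
      isometry_toFun := hiso }
  exact e.completeSpace

end ZernikeAlgebra

/-! ### Analytic extension -/

section AnalyticExtension

open ComplexConjugate MeasureTheory UnitAddTorus

theorem tsum_eq_tsum_zero_add_left {B : Type*} [NormedAddCommGroup B] [CompleteSpace B]
    {f : ℕ × ℕ → B} (hf : Summable f) :
    ∑' p, f p = ∑' b, f (0, b) + ∑' p : ℕ × ℕ, f (p.1 + 1, p.2) := by
  have hf' : Summable fun p : ℕ × ℕ => f (p.1 + 1, p.2) :=
    hf.comp_injective (i := fun p : ℕ × ℕ => (p.1 + 1, p.2))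
      fun p q h => by simpa [Prod.ext_iff] using h
  rw [hf.tsum_prod, hf'.tsum_prod, hf.prod.tsum_eq_zero_add]

theorem tsum_eq_tsum_zero_add_right {B : Type*} [NormedAddCommGroup B] [CompleteSpace B]
    {f : ℕ × ℕ → B} (hf : Summable f) :
    ∑' p, f p = ∑' a, f (a, 0) + ∑' p : ℕ × ℕ, f (p.1, p.2 + 1) := by
  have h := tsum_eq_tsum_zero_add_left (f := fun p => f p.swap) hf.prod_symm
  rw [show ∑' p : ℕ × ℕ, f p.swap = ∑' p, f p from (Equiv.prodComm ℕ ℕ).tsum_eq f] at h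
  rw [h]
  congr 1
  exact (Equiv.prodComm ℕ ℕ).tsum_eq fun p : ℕ × ℕ => f (p.1, p.2 + 1)

/-- The generating function of the disk polynomials, in a Banach algebra: the series is an inverse
of `1 - z s - zb t + s t`. -/
theorem generating_mul_tsum_diskPoly {B : Type*} [NormedCommRing B] [NormedAlgebra ℂ B]
    [CompleteSpace B] (z zb : ℂ) (s t : B)
    (hf : Summable fun p : ℕ × ℕ => diskPoly z zb p.1 p.2 • (s ^ p.1 * t ^ p.2)) :
    (1 - z • s - zb • t + s * t) *
      ∑' p : ℕ × ℕ, diskPoly z zb p.1 p.2 • (s ^ p.1 * t ^ p.2) = 1 := by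
  set f : ℕ × ℕ → B := fun p => diskPoly z zb p.1 p.2 • (s ^ p.1 * t ^ p.2) with hfdef
  have hr : Summable fun p : ℕ × ℕ => f (p.1, p.2 + 1) :=
    hf.comp_injective (i := fun p : ℕ × ℕ => (p.1, p.2 + 1))
      fun p q h => by simpa [Prod.ext_iff] using h
  have hl : Summable fun p : ℕ × ℕ => f (p.1 + 1, p.2) :=
    hf.comp_injective (i := fun p : ℕ × ℕ => (p.1 + 1, p.2))
      fun p q h => by simpa [Prod.ext_iff] using h
  have hA : Summable fun a => f (a, 0) :=
    hf.comp_injective (i := fun a : ℕ => (a, 0)) fun p q h => by simpa using h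
  have hB : Summable fun b => f (0, b) :=
    hf.comp_injective (i := fun b : ℕ => (0, b)) fun p q h => by simpa using h
  have e1 := tsum_eq_tsum_zero_add_left hf
  have e2 := tsum_eq_tsum_zero_add_right hf
  have e3 := tsum_eq_tsum_zero_add_left hr
  have f0 : f (0, 0) = 1 := by simp [hfdef, diskPoly_zero_left]
  have eA : ∑' a, f (a, 0) = 1 + z • s * ∑' a, f (a, 0) := by
    conv_lhs => rw [hA.tsum_eq_zero_add, f0]
    rw [← hA.tsum_mul_left]
    congr 1
    refine tsum_congr fun a => ?_
    simp only [hfdef, diskPoly_zero_right, Algebra.smul_def, map_pow]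
    ring
  have eB' := hB.tsum_eq_zero_add
  have eB : ∑' b, f (0, b) = 1 + zb • t * ∑' b, f (0, b) := by
    conv_lhs => rw [hB.tsum_eq_zero_add, f0]
    rw [← hB.tsum_mul_left]
    congr 1
    refine tsum_congr fun a => ?_
    simp only [hfdef, diskPoly_zero_left, Algebra.smul_def, map_pow]
    ring
  have eP : ∑' p : ℕ × ℕ, f (p.1 + 1, p.2 + 1) = z • s * ∑' p : ℕ × ℕ, f (p.1, p.2 + 1)
      + zb • t * ∑' p : ℕ × ℕ, f (p.1 + 1, p.2) - s * t * ∑' p, f p := by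
    rw [← hr.tsum_mul_left, ← hl.tsum_mul_left, ← hf.tsum_mul_left,
      ← (hr.mul_left _).tsum_add (hl.mul_left _),
      ← ((hr.mul_left _).add (hl.mul_left _)).tsum_sub (hf.mul_left _)]
    refine tsum_congr fun p => ?_
    simp only [hfdef, diskPoly_succ_succ, Algebra.smul_def, map_sub, map_add, map_mul]
    ring
  rw [f0] at eB'
  simp only at e3
  set T := ∑' p, f p
  set A := ∑' a, f (a, 0)
  set C := ∑' b, f (0, b)
  linear_combination eA + eB + (e2 + e3 - eB' + eP) - z • s * e2 - zb • t * e1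

section Extension

variable {B : Type*} [NormedCommRing B] [NormedAlgebra ℂ B] {s t : B} {r : ℝ}

/-- The denominator `1 - z s - zb t + s t` of the generating function in the complexified real
coordinates, that is with `z = x₁ + i x₂` and `zb = x₁ - i x₂` for complex `x₁`, `x₂`. -/
def diskKernel (s t : B) (x : ℂ × ℂ) : B :=
  1 - (x.1 + Complex.I * x.2) • s - (x.1 - Complex.I * x.2) • t + s * t

theorem analyticAt_diskKernel (s t : B) (x : ℂ × ℂ) : AnalyticAt ℂ (diskKernel s t) x := by
  have h1 : AnalyticAt ℂ (fun x : ℂ × ℂ => x.1) x := analyticAt_fst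
  have h2 : AnalyticAt ℂ (fun x : ℂ × ℂ => Complex.I * x.2) x := analyticAt_const.mul analyticAt_snd
  exact ((analyticAt_const.sub ((h1.add h2).smul analyticAt_const)).sub
    ((h1.sub h2).smul analyticAt_const)).add analyticAt_const

variable [CompleteSpace B]

theorem summable_diskFun_smul (hr : 0 ≤ r) (hr1 : r < 1)
    (hst : ∀ i j, ‖s ^ i * t ^ j‖ ≤ r ^ (i + j)) (x : ZDisk) :
    Summable fun p : ℕ × ℕ => diskFun p.1 p.2 x • (s ^ p.1 * t ^ p.2) := by
  refine Summable.of_norm_bounded (g := fun p : ℕ × ℕ => r ^ p.1 * r ^ p.2) ?_ fun p => ?_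
  · exact Summable.mul_of_nonneg (summable_geometric_of_lt_one hr hr1)
      (summable_geometric_of_lt_one hr hr1) (fun _ => by positivity) (fun _ => by positivity)
  · rw [norm_smul, ← pow_add, ← one_mul (r ^ _)]
    exact mul_le_mul (((diskFun p.1 p.2).norm_coe_le_norm x).trans (norm_diskFun_le_one _ _))
      (hst _ _) (norm_nonneg _) zero_le_one

theorem diskKernel_mul_tsum (hr : 0 ≤ r) (hr1 : r < 1)
    (hst : ∀ i j, ‖s ^ i * t ^ j‖ ≤ r ^ (i + j)) (x : ZDisk) :
    diskKernel s t (((x : ℂ).re : ℂ), ((x : ℂ).im : ℂ)) *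
      ∑' p : ℕ × ℕ, diskFun p.1 p.2 x • (s ^ p.1 * t ^ p.2) = 1 := by
  have e1 : (((x : ℂ).re : ℂ) + Complex.I * ((x : ℂ).im : ℂ)) = x := by
    rw [mul_comm, Complex.re_add_im]
  have e2 : (((x : ℂ).re : ℂ) - Complex.I * ((x : ℂ).im : ℂ)) = conj (x : ℂ) := by
    apply Complex.ext <;> simp
  have hs := summable_diskFun_smul hr hr1 hst x
  simp only [diskFun_apply] at hs ⊢
  rw [diskKernel, e1, e2]
  exact generating_mul_tsum_diskPoly _ _ _ _ hs

/-- If the functionals `φ p` extract the coefficients of the power series in `s` and `t`, then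
`x ↦ ∑ c p * φ p ((diskKernel s t x)⁻¹)` is analytic, since inversion in a Banach algebra is, and
it extends the series with coefficients `c`. -/
theorem exists_analytic_extension_of_functionals {ρ : ℝ} (hρ : 1 ≤ ρ) (hr : 0 ≤ r) (hr1 : r < 1)
    (hst : ∀ i j, ‖s ^ i * t ^ j‖ ≤ r ^ (i + j)) (φ : ℕ × ℕ → B →L[ℂ] ℂ) (K : ℝ)
    (hK : ∀ p, ‖φ p‖ ≤ ρ ^ (p.1 + p.2) * K)
    (hφ : ∀ p q : ℕ × ℕ, φ p (s ^ q.1 * t ^ q.2) = if q = p then 1 else 0)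
    {c : ℕ × ℕ → ℂ} (hc : DiskSummable ρ c) :
    ∃ F : ℂ × ℂ → ℂ, AnalyticOnNhd ℂ F {x | IsUnit (diskKernel s t x)} ∧
      ∀ x : ZDisk, F (((x : ℂ).re : ℂ), ((x : ℂ).im : ℂ)) = diskSeries c x := by
  have hs : Summable fun p => c p • φ p := by
    refine Summable.of_norm_bounded (hc.mul_right K) fun p => ?_
    rw [norm_smul, mul_assoc]
    exact mul_le_mul (norm_le_abs₁ _) (hK p) (norm_nonneg _) (abs₁_nonneg _)
  set ψ : B →L[ℂ] ℂ := ∑' p, c p • φ p with hψ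
  have hψm : ∀ q : ℕ × ℕ, ψ (s ^ q.1 * t ^ q.2) = c q := by
    intro q
    have h := hs.hasSum.map (ContinuousLinearMap.apply ℂ ℂ (s ^ q.1 * t ^ q.2))
      (ContinuousLinearMap.apply ℂ ℂ (s ^ q.1 * t ^ q.2)).continuous
    refine h.unique ?_
    convert hasSum_ite_eq q (c q) using 2 with p
    simp only [Function.comp_apply, ContinuousLinearMap.apply_apply,
      smul_apply, hφ, smul_eq_mul, mul_ite, mul_one, mul_zero]
    by_cases h : p = q
    · simp [h]
    · rw [if_neg h, if_neg (Ne.symm h)]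
  refine ⟨fun x => ψ (Ring.inverse (diskKernel s t x)), fun x hx => ?_, fun x => ?_⟩
  · obtain ⟨g, hg⟩ := hx
    refine (ψ.analyticAt _).comp ?_
    refine AnalyticAt.comp (g := Ring.inverse) ?_ (analyticAt_diskKernel s t x)
    rw [← hg]
    exact analyticAt_inverse g
  · have hmul := diskKernel_mul_tsum hr hr1 hst x
    have hinv := Ring.inverse_unit (Units.mkOfMulEqOne _ _ hmul)
    have hinv' : Ring.inverse (diskKernel s t (((x : ℂ).re : ℂ), ((x : ℂ).im : ℂ))) =
        ∑' p : ℕ × ℕ, diskFun p.1 p.2 x • (s ^ p.1 * t ^ p.2) := hinv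
    simp only [hinv']
    have h := (summable_diskFun_smul hr hr1 hst x).hasSum.map ψ ψ.continuous
    refine h.unique ?_
    convert hc.hasSum_apply hρ x using 2 with p
    simp only [Function.comp_apply, map_smul, hψm, smul_eq_mul, mul_comm]

end Extension

/-- Functionals dual to a family of vectors whose images in an inner product space are
orthonormal. -/
theorem exists_biorthogonal_of_orthonormal {ι X H : Type*} [NormedAddCommGroup X] [NormedSpace ℂ X]
    [NormedAddCommGroup H] [InnerProductSpace ℂ H] (T : X →L[ℂ] H) (m : ι → X)
    (h : Orthonormal ℂ fun n => T (m n)) :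
    ∃ (φ : ι → X →L[ℂ] ℂ) (K : ℝ), (∀ n, ‖φ n‖ ≤ K) ∧
      ∀ n, φ n (m n) = 1 ∧ ∀ k, n ≠ k → φ n (m k) = 0 := by
  refine ⟨fun n => (innerSL ℂ (T (m n))).comp T, ‖T‖, fun n => ?_, fun n => ⟨?_, fun k hk => ?_⟩⟩
  · refine (ContinuousLinearMap.opNorm_comp_le _ _).trans ?_
    rw [innerSL_apply_norm, h.1 n, one_mul]
  · simp [inner_self_eq_norm_sq_to_K, h.1 n]
  · simpa using h.2 hk

theorem mFourier_pow_mul_pow (i j : ℕ) :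
    (mFourier (Pi.single 0 1) : C(UnitAddTorus (Fin 2), ℂ)) ^ i * mFourier (Pi.single 1 1) ^ j =
      mFourier ![(i : ℤ), (j : ℤ)] := by
  ext x
  simp only [ContinuousMap.mul_apply, ContinuousMap.pow_apply, mFourier_single]
  simp [mFourier, fourier_apply, AddCircle.toCircle_nsmul]

/-- The Banach algebra is that of continuous functions on the two-dimensional torus, with `s` and
`t` the coordinates scaled to modulus `1 / ρ`; the coefficient functionals are the Fourier
coefficients, whose scaling by `ρ ^ (a + b)` is compensated by the weight in the norm. -/
theorem exists_analytic_extension {ρ : ℝ} (hρ : 1 < ρ) :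
    ∃ U : Set (ℂ × ℂ), IsOpen U ∧
      (∀ x : ZDisk, (((x : ℂ).re : ℂ), ((x : ℂ).im : ℂ)) ∈ U) ∧
      ∀ c, DiskSummable ρ c → ∃ F : ℂ × ℂ → ℂ, AnalyticOnNhd ℂ F U ∧
        ∀ x : ZDisk, F (((x : ℂ).re : ℂ), ((x : ℂ).im : ℂ)) = diskSeries c x := by
  have hρ0 : 0 < ρ := zero_lt_one.trans hρ
  have hρ1 : (ρ : ℂ) ≠ 0 := by exact_mod_cast hρ0.ne'
  obtain ⟨φ, K, hφ, hφm⟩ := exists_biorthogonal_of_orthonormal _ _ (orthonormal_mFourier (d := Fin 2))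
  set s : C(UnitAddTorus (Fin 2), ℂ) := (ρ : ℂ)⁻¹ • mFourier (Pi.single 0 1) with hs
  set t : C(UnitAddTorus (Fin 2), ℂ) := (ρ : ℂ)⁻¹ • mFourier (Pi.single 1 1) with ht
  have hmon : ∀ i j : ℕ, s ^ i * t ^ j = ((ρ : ℂ)⁻¹ ^ (i + j)) • mFourier ![(i : ℤ), (j : ℤ)] := by
    intro i j
    rw [hs, ht, smul_pow, smul_pow, smul_mul_smul_comm, mFourier_pow_mul_pow, ← pow_add]
  have hr0 : 0 ≤ ρ⁻¹ := inv_nonneg.2 hρ0.le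
  have hr1 : ρ⁻¹ < 1 := inv_lt_one_of_one_lt₀ hρ
  have hst : ∀ i j, ‖s ^ i * t ^ j‖ ≤ ρ⁻¹ ^ (i + j) := by
    intro i j
    rw [hmon, norm_smul, mFourier_norm, mul_one, norm_pow, norm_inv, Complex.norm_real,
      Real.norm_of_nonneg hρ0.le]
  refine ⟨{x | IsUnit (diskKernel s t x)}, ?_, fun x => ?_, fun c hc =>
    exists_analytic_extension_of_functionals hρ.le hr0 hr1 hst
      (fun p => ((ρ : ℂ) ^ (p.1 + p.2)) • φ ![(p.1 : ℤ), (p.2 : ℤ)]) K (fun p => ?_)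
      (fun p q => ?_) hc⟩
  · exact Units.isOpen.preimage
      (continuous_iff_continuousAt.2 fun x => (analyticAt_diskKernel s t x).continuousAt)
  · exact ⟨Units.mkOfMulEqOne _ _ (diskKernel_mul_tsum hr0 hr1 hst x), rfl⟩
  · rw [norm_smul, norm_pow, Complex.norm_real, Real.norm_of_nonneg hρ0.le]
    exact mul_le_mul_of_nonneg_left (hφ _) (by positivity)
  · rw [hmon, smul_apply, map_smul, smul_eq_mul, smul_eq_mul]
    split_ifs with h
    · rw [h, (hφm _).1, mul_one, ← mul_pow, mul_inv_cancel₀ hρ1, one_pow]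
    · rw [(hφm _).2, mul_zero, mul_zero]
      intro h'
      refine h (Prod.ext ?_ ?_)
      · simpa using (congrFun h' 0).symm
      · simpa using (congrFun h' 1).symm

end AnalyticExtension

theorem lemma3p1 (ρ : NNReal) (hρ : 1 ≤ ρ) :
    -- families of finite norm correspond bijectively to the functions of the space
    (∀ c : ZIndex → ℂ, ZernikeSummable ρ c → ∃ u : ZDisk → ℂ, IsZernikeExpansion ρ c u) ∧
    (∀ u ∈ zernikeSpace ρ, ∃! c : ZIndex → ℂ, IsZernikeExpansion ρ c u) ∧
    -- the space is a subalgebra of the pointwise algebra, and a Banach algebra in its norm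
    (∃ (S : Subalgebra ℝ (ZDisk → ℂ)) (N : AlgebraNorm ℝ S),
      Subalgebra.toSubmodule S = zernikeSpace ρ ∧
      (∀ (u : S) (c : ZIndex → ℂ), IsZernikeExpansion ρ c (u : ZDisk → ℂ) →
        N u = zernikeNorm ρ c) ∧
      @CompleteSpace S
        N.toRingNorm.toNormedRing.toMetricSpace.toPseudoMetricSpace.toUniformSpace) ∧
    -- for `ρ > 1`, analytic extension to an open neighborhood of the disk in `ℂ²`
    (1 < ρ →
      ∃ U : Set (ℂ × ℂ), IsOpen U ∧
        (∀ z : ZDisk, (((z : ℂ).re : ℂ), ((z : ℂ).im : ℂ)) ∈ U) ∧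
        ∀ u ∈ zernikeSpace ρ, ∃ F : ℂ × ℂ → ℂ, AnalyticOnNhd ℂ F U ∧
          ∀ z : ZDisk, F (((z : ℂ).re : ℂ), ((z : ℂ).im : ℂ)) = u z) := by
  refine ⟨fun c hc => ⟨_, (isZernikeExpansion_iff hρ).2 ⟨hc, rfl⟩⟩, ?_,
    ⟨zernikeAlgebra hρ, zernikeAlgebraNorm hρ, Submodule.toSubalgebra_toSubmodule _ _ _, ?_,
      completeSpace_zernikeAlgebra hρ⟩, fun hρ' => ?_⟩
  · rintro u ⟨c, hc⟩
    exact ⟨c, hc, fun d hd => IsZernikeExpansion.unique hρ hd hc⟩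
  · intro u c hc
    rw [zernikeAlgebraNorm_apply, zernikeCoeff_eq hρ hc]
  · obtain ⟨U, hU, hmem, hF⟩ := exists_analytic_extension (ρ := ρ) (by exact_mod_cast hρ')
    refine ⟨U, hU, hmem, ?_⟩
    rintro u ⟨c, hc⟩
    obtain ⟨hcs, rfl⟩ := (isZernikeExpansion_iff hρ).1 hc
    exact hF _ (diskSummable_comp_iff.2 hcs)
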